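/- All Hilbert spaces are finite-dimensional, all alphabets are finite, and $\log$ is to base $2$, with $-\log 0=+\infty$. A cq-state is a density operator of the form $\rho_{XE}=\sum_x P_X(x)\,|x\rangle\langle x|\otimes\rho_E^x$, where $P_X$ is a probability distribution and the $\rho_E^x$ are density operators. For positive semidefinite $\rho_{AB}$ let $$H_\infty(A|B)_\rho=-\log\min\{\operatorname{Tr}\sigma_B:\ \sigma_B\ge 0,\ \rho_{AB}\le \mathrm{id}_A\otimes\sigma_B\},$$ and for $\varepsilon\ge 0$ and a state $\rho_{AB}$ let $$H_\infty^{\varepsilon}(A|B)_\rho=\sup\{H_\infty(A|B)_{\hat\rho}:\ \hat\rho_{AB}\ge 0,\ \operatorname{Tr}\hat\rho_{AB}\le 1,\ C(\rho_{AB},\hat\rho_{AB})\le\varepsilon\},$$ where $C(\rho,\sigma)=\sqrt{1-F(\rho,\sigma)^2}$, $F(\rho,\sigma)=\|\sqrt\rho\sqrt\sigma\|_1$, and $\|A\|_1=\operatorname{Tr}\sqrt{A^\dagger A}$. **Lemma.** Let $\varepsilon\ge 0$, $m\ge 1$ and $\alpha\in\mathbb R$. Let $\rho_{XE}=\bigotimes_{i=1}^{m}\rho_{X_iE_i}$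 be a product of $m$ cq-states, where $X=(X_1,\dots,X_m)$ and $E=(E_1,\dots,E_m)$, such that $H_\infty^{\varepsilon^2}(X_iX_j|E)_\rho\ge\alpha$ for all $i\ne j$. Then there is a random variable $V$ with values in $\{1,\dots,m\}$, that is, a state $\rho_{XVE}$ in which $X$ and $V$ are classical and whose reduced state on $XE$ is $\rho_{XE}$, such that for every $v\in\{1,\dots,m\}$ with $P[V\ne v]>0$ $$H_\infty^{\varepsilon}(X_v\,|\,E_vV,\ V\ne v)\ \ge\ \frac{\alpha}{2}-\log m ,$$ where the entropy on the left is that of the reduced state on $X_vE_vV$ of the normalized state $\rho_{XVE}$ conditioned on the event $V\ne v$. -/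

import Mathlib

open scoped ComplexOrder MatrixOrder Kronecker

noncomputable section

namespace QInfo

open Matrix

/-! Finite-dimensional Hilbert spaces are presented through an orthonormal basis indexed by a
finite type, so an operator on the space with basis `n` is a matrix in `Matrix n n ℂ`, and the
tensor product of the spaces with bases `a` and `b` has basis `a × b`. -/

/-- A quantum state: a positive semidefinite operator of trace one. -/
def IsState {n : Type*} [Fintype n] (ρ : Matrix n n ℂ) : Prop :=
  ρ.PosSemidef ∧ ρ.trace = 1

/-- A cq-state `ρ_{XE} = ∑ₓ P_X(x) |x⟩⟨x| ⊗ ρ_E^x`, with `P_X` a probability distribution on the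
finite alphabet `X` and every `ρ_E^x` a quantum state. -/
def IsCQState {X E : Type*} [Fintype X] [DecidableEq X] [Fintype E]
    (ρ : Matrix (X × E) (X × E) ℂ) : Prop :=
  ∃ (P : X → ℝ) (ρE : X → Matrix E E ℂ),
    (∀ x, 0 ≤ P x) ∧ ∑ x, P x = 1 ∧ (∀ x, IsState (ρE x)) ∧
      ρ = ∑ x, (P x : ℂ) • (Matrix.single x x (1 : ℂ) ⊗ₖ ρE x)

/-- The trace norm `‖A‖₁ = Tr √(A† A)`. -/
def traceNorm {n : Type*} [Fintype n] [DecidableEq n] (A : Matrix n n ℂ) : ℝ :=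
  (CFC.sqrt (Aᴴ * A)).trace.re

/-- The fidelity `F(ρ, σ) = ‖√ρ √σ‖₁`. -/
def fidelity {n : Type*} [Fintype n] [DecidableEq n] (ρ σ : Matrix n n ℂ) : ℝ :=
  traceNorm (CFC.sqrt ρ * CFC.sqrt σ)

/-- The distance `C(ρ, σ) = √(1 - F(ρ, σ)²)`. -/
def cDist {n : Type*} [Fintype n] [DecidableEq n] (ρ σ : Matrix n n ℂ) : ℝ :=
  Real.sqrt (1 - fidelity ρ σ ^ 2)

/-- The logarithm to base two of a nonnegative real, with `log 0 = -∞`. -/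
def log2 (t : ℝ) : EReal :=
  if t ≤ 0 then ⊥ else ((Real.logb 2 t : ℝ) : EReal)

/-- The conditional min-entropy
`H_∞(A|B)_ρ = - log min {Tr σ_B | σ_B ≥ 0, ρ_{AB} ≤ id_A ⊗ σ_B}`. -/
def minEntropy {a b : Type*} [Fintype a] [DecidableEq a] [Fintype b]
    (ρ : Matrix (a × b) (a × b) ℂ) : EReal :=
  -log2 (sInf {t : ℝ | ∃ σ : Matrix b b ℂ, σ.PosSemidef ∧
    ((1 : Matrix a a ℂ) ⊗ₖ σ - ρ).PosSemidef ∧ t = σ.trace.re})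

/-- The ball `K^ε(ρ)` of subnormalized positive semidefinite operators within `C`-distance `ε`. -/
def smoothBall {n : Type*} [Fintype n] [DecidableEq n] (ε : ℝ) (ρ : Matrix n n ℂ) :
    Set (Matrix n n ℂ) :=
  {τ | τ.PosSemidef ∧ cDist ρ τ ≤ ε ∧ τ.trace.re ≤ 1}

/-- The conditional `ε`-smooth min-entropy `H_∞^ε(A|B)_ρ = sup {H_∞(A|B)_τ | τ ∈ K^ε(ρ)}`. -/
def smoothMinEntropy {a b : Type*} [Fintype a] [DecidableEq a] [Fintype b] [DecidableEq b]
    (ε : ℝ) (ρ : Matrix (a × b) (a × b) ℂ) : EReal :=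
  ⨆ τ ∈ smoothBall ε ρ, minEntropy τ

/-- The partial trace, for a system with basis `n` that is identified with the composite of
subsystems with bases `a` and `b` through the bijection `p ↦ (keep p, discard p)`:
the subsystem `b` is traced out. -/
def partialTrace {n a b : Type*} [Fintype n] [DecidableEq a] [DecidableEq b]
    (keep : n → a) (discard : n → b) (M : Matrix n n ℂ) : Matrix a a ℂ :=
  Matrix.of fun s t => ∑ p, ∑ q,
    if keep p = s ∧ keep q = t ∧ discard p = discard q then M p q else 0

/-- On a product basis this is the usual partial trace over the second factor. -/
theorem partialTrace_fst_snd {a b : Type*} [Fintype a] [DecidableEq a] [Fintype b]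
    [DecidableEq b] (M : Matrix (a × b) (a × b) ℂ) (s t : a) :
    partialTrace Prod.fst Prod.snd M s t = ∑ y, M (s, y) (t, y) := by
  simp [partialTrace, Fintype.sum_prod_type, ite_and, Finset.sum_ite_irrel]

section Registers

variable {m : ℕ} {X E : Fin m → Type*}

/-- The product state `⨂ᵢ ρ_{XᵢEᵢ}`, with all `X`-registers listed before all `E`-registers. -/
def productState (ρ : ∀ i, Matrix (X i × E i) (X i × E i) ℂ) :
    Matrix ((∀ i, X i) × (∀ i, E i)) ((∀ i, X i) × (∀ i, E i)) ℂ :=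
  Matrix.of fun p q => ∏ i, ρ i (p.1 i, p.2 i) (q.1 i, q.2 i)

variable [∀ i, Fintype (X i)] [∀ i, DecidableEq (X i)] [∀ i, Fintype (E i)]
  [∀ i, DecidableEq (E i)]

/-- The reduced state on `Xᵢ Xⱼ E`, where `i ≠ j` and `E` consists of all registers `E₀, …`. -/
def pairState (ρ : Matrix ((∀ k, X k) × (∀ k, E k)) ((∀ k, X k) × (∀ k, E k)) ℂ)
    (i j : Fin m) :
    Matrix ((X i × X j) × (∀ k, E k)) ((X i × X j) × (∀ k, E k)) ℂ :=
  partialTrace (fun p => ((p.1 i, p.1 j), p.2))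
    (fun p => fun k : {k : Fin m // k ≠ i ∧ k ≠ j} => p.1 k) ρ

/-- The reduced state on `X E` of a state on `X V E`. -/
def forgetV (τ : Matrix (((∀ k, X k) × Fin m) × (∀ k, E k))
      (((∀ k, X k) × Fin m) × (∀ k, E k)) ℂ) :
    Matrix ((∀ k, X k) × (∀ k, E k)) ((∀ k, X k) × (∀ k, E k)) ℂ :=
  partialTrace (fun p => (p.1.1, p.2)) (fun p => p.1.2) τ

/-- The reduced state on `X_v E_v V` of a state on `X V E`, with `X_v` as first subsystem. -/
def localState (τ : Matrix (((∀ k, X k) × Fin m) × (∀ k, E k))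
      (((∀ k, X k) × Fin m) × (∀ k, E k)) ℂ) (v : Fin m) :
    Matrix (X v × (E v × Fin m)) (X v × (E v × Fin m)) ℂ :=
  partialTrace (fun p => (p.1.1 v, (p.2 v, p.1.2)))
    (fun p => ((fun k : {k : Fin m // k ≠ v} => p.1.1 k),
      (fun k : {k : Fin m // k ≠ v} => p.2 k))) τ

/-- The probability `P[V ≠ v]` for the classical register `V`. -/
def probNe (τ : Matrix (((∀ k, X k) × Fin m) × (∀ k, E k))
      (((∀ k, X k) × Fin m) × (∀ k, E k)) ℂ) (v : Fin m) : ℝ :=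
  ∑ p, if p.1.2 ≠ v then (τ p p).re else 0

/-- The normalized state of `X V E` conditioned on the event `V ≠ v`. -/
def condNe (τ : Matrix (((∀ k, X k) × Fin m) × (∀ k, E k))
      (((∀ k, X k) × Fin m) × (∀ k, E k)) ℂ) (v : Fin m) :
    Matrix (((∀ k, X k) × Fin m) × (∀ k, E k)) (((∀ k, X k) × Fin m) × (∀ k, E k)) ℂ :=
  Matrix.of fun p q =>
    if p.1.2 ≠ v ∧ q.1.2 ≠ v then ((probNe τ v)⁻¹ : ℂ) * τ p q else 0

end Registers

end QInfo

end

/-!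
The variable `V` can be taken constant, `V = v₀`, as soon as `v₀` is the only register whose smooth
min-entropy may be small; so it suffices that no two registers `i ≠ j` have small smooth
min-entropy. Maximizing the fidelity with `ρ` over the operators of min-entropy at least `β` is a
concave optimization problem, and Lagrange duality shows that `H^ε(ρ) < β` is certified by an
operator `W ≥ 0` and a real number `r > 0` with `2^{-β} Tr_X W ≤ 1` and
`(1 + r) Tr (ρ (1 + r W)⁻¹) < 1 - ε²`. Up to a factor `3`, the tensor product of such operators for
`ρ_i` and `ρ_j` certifies that the squared fidelity of `ρ_i ⊗ ρ_j` with every operator of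
min-entropy at least `β + β' + log 3` is below `1 - ε⁴`, whence
`H^{ε²}(X_i X_j | E) ≤ β + β' + log 3`. This is below `α` when `β` and `β'` are below
`(α - log 3) / 2`, and `(log 3) / 2 ≤ log m` for `m ≥ 2`.
-/

namespace QInfo

open Matrix

section ScalarInequalities

variable {κ ι : Type*} [Fintype κ] [Fintype ι]

/- The right-hand side is the tangent at `A` of the concave function `a ↦ a r / (a r + (1 - a) y)`,
whose value at `a = (1 + r x)⁻¹` is the left-hand side. -/
theorem inv_one_add_mul_le_tangent {r x y A : ℝ} (hr : 0 < r) (hx : 0 ≤ x) (hy : 0 ≤ y)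
    (hyr : y ≤ r) (hA : 0 < A) (hA1 : A ≤ 1) :
    (1 + x * y)⁻¹ ≤ A * r / (A * r + (1 - A) * y) +
      r * y / (A * r + (1 - A) * y) ^ 2 * ((1 + r * x)⁻¹ - A) := by
  have hD : 0 < A * r + (1 - A) * y :=
    add_pos_of_pos_of_nonneg (mul_pos hA hr) (mul_nonneg (sub_nonneg.2 hA1) hy)
  generalize hDdef : A * r + (1 - A) * y = D at hD ⊢
  have := mul_nonneg hr.le hx
  have := mul_nonneg hx hy
  have hgap : A * r / D + r * y / D ^ 2 * ((1 + r * x)⁻¹ - A) - (1 + x * y)⁻¹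
      = y * (r - y) * (1 - A * (1 + r * x)) ^ 2 / (D ^ 2 * (1 + r * x) * (1 + x * y)) := by
    field_simp
    rw [← hDdef]
    ring
  have hgap0 : 0 ≤ y * (r - y) * (1 - A * (1 + r * x)) ^ 2 /
      (D ^ 2 * (1 + r * x) * (1 + x * y)) := by
    have := sub_nonneg.2 hyr
    positivity
  linarith

theorem mul_div_add_le_add_mul_inv {r y A : ℝ} (hr : 0 < r) (hy : 0 ≤ y) (hA : 0 < A)
    (hA1 : (1 + r) * A ≤ 1) :
    A * r / (A * r + (1 - A) * y) ≤ A + (1 - A) * (1 + y)⁻¹ := by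
  have hA1' : 0 ≤ 1 - A := by nlinarith
  calc A * r / (A * r + (1 - A) * y) ≤ (1 + A * y) / (1 + y) := by
        rw [div_le_div_iff₀ (by positivity) (by positivity)]
        have h := mul_nonneg (mul_nonneg hA1' hy) (by nlinarith : 0 ≤ 1 + A * y - A * r)
        nlinarith
    _ = A + (1 - A) * (1 + y)⁻¹ := by field_simp; ring

theorem sum_mul_inv_pos {p x : κ → ℝ} (hp : ∀ k, 0 ≤ p k) (hp1 : ∑ k, p k = 1)
    (hx : ∀ k, 0 < x k) : 0 < ∑ k, p k * (x k)⁻¹ := by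
  obtain ⟨k, -, hk⟩ := Finset.exists_lt_of_sum_lt
    (by simp [hp1] : ∑ _k : κ, (0 : ℝ) < ∑ k, p k)
  exact Finset.sum_pos' (fun k _ => mul_nonneg (hp k) (inv_nonneg.2 (hx k).le))
    ⟨k, Finset.mem_univ k, mul_pos hk (inv_pos.2 (hx k))⟩

theorem sum_mul_inv_one_add_mul_le {p x : κ → ℝ} (hp : ∀ k, 0 ≤ p k) (hp1 : ∑ k, p k = 1)
    (hx : ∀ k, 0 ≤ x k) {r y A : ℝ} (hr : 0 < r) (hy : 0 ≤ y)
    (hA : ∑ k, p k * (1 + r * x k)⁻¹ = A) (hA1 : (1 + r) * A ≤ 1) :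
    ∑ k, p k * (1 + x k * y)⁻¹ ≤ A + (1 - A) * (1 + y)⁻¹ := by
  have hA0 : 0 < A := by
    rw [← hA]
    exact sum_mul_inv_pos hp hp1 fun k => by have := hx k; positivity
  have hA1' : A ≤ 1 := by nlinarith
  rcases le_total r y with hry | hyr
  · calc ∑ k, p k * (1 + x k * y)⁻¹ ≤ ∑ k, p k * (1 + r * x k)⁻¹ := by
          refine Finset.sum_le_sum fun k _ => mul_le_mul_of_nonneg_left ?_ (hp k)
          have := hx k
          exact inv_anti₀ (by positivity) (by nlinarith)
      _ = A := hA
      _ ≤ A + (1 - A) * (1 + y)⁻¹ :=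
          le_add_of_nonneg_right (mul_nonneg (sub_nonneg.2 hA1') (by positivity))
  · set D := A * r + (1 - A) * y
    calc ∑ k, p k * (1 + x k * y)⁻¹
        ≤ ∑ k, p k * (A * r / D + r * y / D ^ 2 * ((1 + r * x k)⁻¹ - A)) :=
          Finset.sum_le_sum fun k _ => mul_le_mul_of_nonneg_left
            (inv_one_add_mul_le_tangent hr (hx k) hy hyr hA0 hA1') (hp k)
      _ = A * r / D * ∑ k, p k +
            r * y / D ^ 2 * (∑ k, p k * (1 + r * x k)⁻¹ - A * ∑ k, p k) := by
          simp only [Finset.mul_sum, ← Finset.sum_sub_distrib, ← Finset.sum_add_distrib]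
          exact Finset.sum_congr rfl fun k _ => by ring
      _ = A * r / D := by rw [hA, hp1]; ring
      _ ≤ A + (1 - A) * (1 + y)⁻¹ := mul_div_add_le_add_mul_inv hr hy hA0 hA1

theorem inv_one_add_mul_le {u v : ℝ} (hu : 0 ≤ u) (hv : 0 ≤ v) :
    (1 + u * v)⁻¹ ≤ (1 + u)⁻¹ + (1 + v)⁻¹ - (1 + u)⁻¹ * (1 + v)⁻¹ := by
  have h : (1 + u)⁻¹ + (1 + v)⁻¹ - (1 + u)⁻¹ * (1 + v)⁻¹ = (1 + u + v) / ((1 + u) * (1 + v)) := by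
    field_simp
    ring
  rw [h, inv_eq_one_div, div_le_div_iff₀ (by positivity) (by positivity)]
  nlinarith [mul_nonneg hu hv, mul_nonneg hu (mul_nonneg hu hv), mul_nonneg hv (mul_nonneg hu hv)]

theorem sum_sum_mul_inv_le {p x : κ → ℝ} {q y : ι → ℝ} (hp : ∀ k, 0 ≤ p k) (hq : ∀ l, 0 ≤ q l)
    (hp1 : ∑ k, p k = 1) (hq1 : ∑ l, q l = 1) (hx : ∀ k, 0 ≤ x k) (hy : ∀ l, 0 ≤ y l) :
    ∑ k, ∑ l, p k * q l * (1 + x k * y l)⁻¹ ≤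
      ∑ k, p k * (1 + x k)⁻¹ + ∑ l, q l * (1 + y l)⁻¹ -
        (∑ k, p k * (1 + x k)⁻¹) * ∑ l, q l * (1 + y l)⁻¹ := by
  calc ∑ k, ∑ l, p k * q l * (1 + x k * y l)⁻¹
      ≤ ∑ k, ∑ l, (p k * (1 + x k)⁻¹ * q l + p k * (q l * (1 + y l)⁻¹)
          - p k * (1 + x k)⁻¹ * (q l * (1 + y l)⁻¹)) := by
        refine Finset.sum_le_sum fun k _ => Finset.sum_le_sum fun l _ => ?_
        have := mul_le_mul_of_nonneg_left (inv_one_add_mul_le (hx k) (hy l))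
          (mul_nonneg (hp k) (hq l))
        linarith
    _ = _ := by
        simp only [Finset.sum_sub_distrib, Finset.sum_add_distrib, ← Finset.mul_sum,
          ← Finset.sum_mul, hp1, hq1, one_mul, mul_one]

theorem one_add_mul_le_one_sub_mul {r s R A B : ℝ} (hA : 0 ≤ A) (hB : 0 ≤ B)
    (hA1 : (1 + r) * A ≤ 1) (hB1 : (1 + s) * B ≤ 1) (hRr : R ≤ r) (hRs : R ≤ s)
    (hR : R * (1 + r + s) ≤ r * s) :
    (1 + R) * (A + B - A * B) ≤ 1 - (1 - (1 + r) * A) * (1 - (1 + s) * B) := by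
  have h1 := mul_nonneg (mul_nonneg hA (sub_nonneg.2 hB1)) (sub_nonneg.2 hRr)
  have h2 := mul_nonneg (mul_nonneg hB (sub_nonneg.2 hA1)) (sub_nonneg.2 hRs)
  have h3 := mul_nonneg (mul_nonneg hA hB) (sub_nonneg.2 hR)
  linarith

theorem exists_sum_sum_mul_inv_le_of_le {p x : κ → ℝ} {q y : ι → ℝ} (hp : ∀ k, 0 ≤ p k)
    (hq : ∀ l, 0 ≤ q l) (hp1 : ∑ k, p k = 1) (hq1 : ∑ l, q l = 1) (hx : ∀ k, 0 ≤ x k)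
    (hy : ∀ l, 0 ≤ y l) {r s A B : ℝ} (hs : 0 < s) (hsr : s ≤ r)
    (hA : ∑ k, p k * (1 + r * x k)⁻¹ = A) (hA1 : (1 + r) * A ≤ 1)
    (hB : ∑ l, q l * (1 + s * y l)⁻¹ = B) (hB1 : (1 + s) * B ≤ 1) :
    ∃ R : ℝ, 0 < R ∧ (1 + R) * ∑ k, ∑ l, p k * q l * (1 + 3 * R * (x k * y l))⁻¹ ≤
      1 - (1 - (1 + r) * A) * (1 - (1 + s) * B) := by
  have hr : 0 < r := hs.trans_le hsr
  have hrx : ∀ k, 0 ≤ r * x k := fun k => mul_nonneg hr.le (hx k)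
  have hsy : ∀ l, 0 ≤ s * y l := fun l => mul_nonneg hs.le (hy l)
  have hA0 : 0 ≤ A := hA ▸ (sum_mul_inv_pos hp hp1 fun k => by linarith [hrx k]).le
  have hB0 : 0 ≤ B := hB ▸ (sum_mul_inv_pos hq hq1 fun l => by linarith [hsy l]).le
  suffices h : ∃ R : ℝ, 0 < R ∧ R ≤ s ∧ R * (1 + r + s) ≤ r * s ∧
      ∑ k, ∑ l, p k * q l * (1 + 3 * R * (x k * y l))⁻¹ ≤ A + B - A * B by
    obtain ⟨R, hR, hRs, hRrs, hsum⟩ := h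
    exact ⟨R, hR, (mul_le_mul_of_nonneg_left hsum (by positivity)).trans
      (one_add_mul_le_one_sub_mul hA0 hB0 hA1 hB1 (hRs.trans hsr) hRs hRrs)⟩
  rcases le_total r 1 with hr1 | hr1
  · refine ⟨r * s / 3, by positivity, by nlinarith, by nlinarith [mul_pos hr hs], ?_⟩
    have h := sum_sum_mul_inv_le hp hq hp1 hq1 hrx hsy
    rw [hA, hB] at h
    have hrs : ∀ k l, 3 * (r * s / 3) * (x k * y l) = r * x k * (s * y l) := fun k l => by ring
    simpa only [hrs] using h
  · refine ⟨s / 3, by positivity, by linarith, by nlinarith, ?_⟩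
    calc ∑ k, ∑ l, p k * q l * (1 + 3 * (s / 3) * (x k * y l))⁻¹
        = ∑ l, q l * ∑ k, p k * (1 + x k * (s * y l))⁻¹ := by
          rw [Finset.sum_comm]
          simp only [Finset.mul_sum]
          refine Finset.sum_congr rfl fun l _ => Finset.sum_congr rfl fun k _ => ?_
          rw [show 3 * (s / 3) * (x k * y l) = x k * (s * y l) by ring]
          ring
      _ ≤ ∑ l, q l * (A + (1 - A) * (1 + s * y l)⁻¹) :=
          Finset.sum_le_sum fun l _ => mul_le_mul_of_nonneg_left
            (sum_mul_inv_one_add_mul_le hp hp1 hx hr (hsy l) hA hA1) (hq l)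
      _ = A * ∑ l, q l + (1 - A) * ∑ l, q l * (1 + s * y l)⁻¹ := by
          simp only [Finset.mul_sum, ← Finset.sum_add_distrib]
          exact Finset.sum_congr rfl fun l _ => by ring
      _ = A + B - A * B := by rw [hq1, hB]; ring

/- The constant `3` reconciles the two regimes of the proof, `R = r s / 3` for `r ≤ 1` and
`R = s / 3` for `1 ≤ r` (where `s ≤ r`). -/
theorem exists_sum_sum_mul_inv_le {p x : κ → ℝ} {q y : ι → ℝ} (hp : ∀ k, 0 ≤ p k)
    (hq : ∀ l, 0 ≤ q l) (hp1 : ∑ k, p k = 1) (hq1 : ∑ l, q l = 1) (hx : ∀ k, 0 ≤ x k)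
    (hy : ∀ l, 0 ≤ y l) {r s : ℝ} (hr : 0 < r) (hs : 0 < s)
    (hr1 : (1 + r) * ∑ k, p k * (1 + r * x k)⁻¹ ≤ 1)
    (hs1 : (1 + s) * ∑ l, q l * (1 + s * y l)⁻¹ ≤ 1) :
    ∃ R : ℝ, 0 < R ∧ (1 + R) * ∑ k, ∑ l, p k * q l * (1 + 3 * R * (x k * y l))⁻¹ ≤
      1 - (1 - (1 + r) * ∑ k, p k * (1 + r * x k)⁻¹) *
        (1 - (1 + s) * ∑ l, q l * (1 + s * y l)⁻¹) := by
  rcases le_total s r with h | h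
  · exact exists_sum_sum_mul_inv_le_of_le hp hq hp1 hq1 hx hy hs h rfl hr1 rfl hs1
  · obtain ⟨R, hR, hle⟩ :=
      exists_sum_sum_mul_inv_le_of_le hq hp hq1 hp1 hy hx hr h rfl hs1 rfl hr1
    rw [Finset.sum_comm] at hle
    refine ⟨R, hR, ?_⟩
    rw [mul_comm (1 - (1 + r) * _)]
    simpa only [mul_comm (q _) (p _), mul_comm (y _) (x _)] using hle

end ScalarInequalities

section Measurement

variable {n : Type*} [Fintype n]

theorem re_trace_nonneg {A : Matrix n n ℂ} (hA : A.PosSemidef) : 0 ≤ A.trace.re :=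
  (Complex.nonneg_iff.1 hA.trace_nonneg).1

/-- The distribution of the outcome of measuring the state `ρ` in the orthonormal basis formed by
the columns of the unitary `U`. -/
def measureDist (ρ U : Matrix n n ℂ) (i : n) : ℝ :=
  ((Uᴴ * ρ * U) i i).re

theorem measureDist_nonneg {ρ : Matrix n n ℂ} (hρ : ρ.PosSemidef) (U : Matrix n n ℂ) (i : n) :
    0 ≤ measureDist ρ U i :=
  (Complex.nonneg_iff.1 (hρ.conjTranspose_mul_mul_same U).diag_nonneg).1

end Measurement

section Spectral

variable {n m : Type*} [Fintype n] [DecidableEq n] [Fintype m] [DecidableEq m]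

/-- The operator `U diag(h) U†`. Writing commuting operators in this form, with a common unitary
`U`, turns computations with them into computations with functions. -/
def specOp (U : Matrix n n ℂ) (h : n → ℝ) : Matrix n n ℂ :=
  U * diagonal (fun i => (h i : ℂ)) * Uᴴ

theorem specOp_mul_specOp {U : Matrix n n ℂ} (hU : U ∈ unitaryGroup n ℂ) (g h : n → ℝ) :
    specOp U g * specOp U h = specOp U (g * h) := by
  have hU' : Uᴴ * U = 1 := mem_unitaryGroup_iff'.1 hU
  calc specOp U g * specOp U h
      = U * (diagonal (fun i => (g i : ℂ)) * (Uᴴ * U) * diagonal (fun i => (h i : ℂ))) * Uᴴ := by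
        simp only [specOp, Matrix.mul_assoc]
    _ = specOp U (g * h) := by
        simp only [hU', Matrix.mul_one, diagonal_mul_diagonal, specOp, Pi.mul_apply,
          Complex.ofReal_mul]

theorem specOp_one {U : Matrix n n ℂ} (hU : U ∈ unitaryGroup n ℂ) : specOp U 1 = 1 := by
  have hU' : U * Uᴴ = 1 := mem_unitaryGroup_iff.1 hU
  simp [specOp, hU']

theorem specOp_add (U : Matrix n n ℂ) (g h : n → ℝ) :
    specOp U (g + h) = specOp U g + specOp U h := by
  simp only [specOp, Pi.add_apply, Complex.ofReal_add, ← diagonal_add, Matrix.mul_add,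
    Matrix.add_mul]

theorem specOp_smul (U : Matrix n n ℂ) (c : ℝ) (h : n → ℝ) :
    specOp U (c • h) = c • specOp U h := by
  have hdiag : diagonal (fun i => (((c • h) i : ℝ) : ℂ)) = c • diagonal (fun i => (h i : ℂ)) := by
    ext i j
    by_cases hij : i = j <;> simp [diagonal, hij]
  simp only [specOp, hdiag, Matrix.mul_smul, Matrix.smul_mul]

theorem isHermitian_specOp (U : Matrix n n ℂ) (h : n → ℝ) : (specOp U h).IsHermitian :=
  isHermitian_mul_mul_conjTranspose U
    (isHermitian_diagonal_of_self_adjoint _ (funext fun i => by simp))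

theorem posSemidef_specOp (U : Matrix n n ℂ) {h : n → ℝ} (hh : 0 ≤ h) :
    (specOp U h).PosSemidef :=
  PosSemidef.mul_mul_conjTranspose_same
    (PosSemidef.diagonal fun i => by simpa using hh i) U

theorem specOp_inv {U : Matrix n n ℂ} (hU : U ∈ unitaryGroup n ℂ) {h : n → ℝ}
    (hh : ∀ i, h i ≠ 0) : (specOp U h)⁻¹ = specOp U h⁻¹ := by
  refine inv_eq_right_inv ?_
  rw [specOp_mul_specOp hU, show h * h⁻¹ = 1 from funext fun i => mul_inv_cancel₀ (hh i),
    specOp_one hU]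

theorem specOp_kronecker (U : Matrix n n ℂ) (V : Matrix m m ℂ) (g : n → ℝ) (h : m → ℝ) :
    specOp U g ⊗ₖ specOp V h = specOp (U ⊗ₖ V) (fun k => g k.1 * h k.2) := by
  have hdiag : diagonal (fun k : n × m => ((g k.1 * h k.2 : ℝ) : ℂ))
      = diagonal (fun i => (g i : ℂ)) ⊗ₖ diagonal (fun j => (h j : ℂ)) := by
    simp only [diagonal_kronecker_diagonal, Complex.ofReal_mul]
  simp only [specOp, hdiag, conjTranspose_kronecker, mul_kronecker_mul]

theorem re_trace_mul_specOp (ρ U : Matrix n n ℂ) (h : n → ℝ) :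
    (ρ * specOp U h).trace.re = ∑ i, measureDist ρ U i * h i := by
  have hcycl : (ρ * specOp U h).trace
      = (Uᴴ * ρ * U * diagonal (fun i => (h i : ℂ))).trace := by
    rw [specOp, ← Matrix.mul_assoc, trace_mul_comm]
    simp only [Matrix.mul_assoc]
  rw [hcycl]
  simp [trace, mul_diagonal, measureDist]

theorem exists_specOp_of_posSemidef {W : Matrix n n ℂ} (hW : W.PosSemidef) :
    ∃ U ∈ unitaryGroup n ℂ, ∃ w : n → ℝ, 0 ≤ w ∧ W = specOp U w := by
  refine ⟨hW.1.eigenvectorUnitary, hW.1.eigenvectorUnitary.2, hW.1.eigenvalues,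
    hW.eigenvalues_nonneg, ?_⟩
  conv_lhs => rw [hW.1.spectral_theorem, Unitary.conjStarAlgAut_apply]
  rfl

theorem exists_pinv_of_posSemidef {n : Type*} [Fintype n] {P : Matrix n n ℂ} (hP : P.PosSemidef) :
    ∃ J : Matrix n n ℂ, Jᴴ = J ∧ J * P = P * J ∧ P * J * P = P ∧ J * P * J = J := by
  classical
  obtain ⟨U, hU, w, -, rfl⟩ := exists_specOp_of_posSemidef hP
  refine ⟨specOp U w⁻¹, isHermitian_specOp _ _, ?_, ?_, ?_⟩
  · simp only [specOp_mul_specOp hU, mul_comm]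
  · rw [specOp_mul_specOp hU, specOp_mul_specOp hU]
    exact congrArg _ (funext fun i => mul_inv_mul_cancel (w i))
  · rw [specOp_mul_specOp hU, specOp_mul_specOp hU]
    exact congrArg _ (funext fun i => by simpa using mul_inv_mul_cancel (w i)⁻¹)

theorem sum_measureDist (ρ : Matrix n n ℂ) {U : Matrix n n ℂ} (hU : U ∈ unitaryGroup n ℂ) :
    ∑ i, measureDist ρ U i = ρ.trace.re := by
  simpa [specOp_one hU] using (re_trace_mul_specOp ρ U 1).symm

end Spectral

section TraceInequalities

variable {l m n : Type*} [Fintype l] [Fintype m] [Fintype n]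

theorem re_trace_mono {A B : Matrix n n ℂ} (hAB : A ≤ B) : A.trace.re ≤ B.trace.re := by
  simpa using re_trace_nonneg (le_iff.1 hAB)

theorem re_trace_conjTranspose (A : Matrix n n ℂ) : Aᴴ.trace.re = A.trace.re := by
  simp [trace_conjTranspose]

theorem re_trace_conjTranspose_mul_sq_le (A B : Matrix m n ℂ) :
    (Aᴴ * B).trace.re ^ 2 ≤ (Aᴴ * A).trace.re * (Bᴴ * B).trace.re := by
  have hsymm : (Bᴴ * A).trace.re = (Aᴴ * B).trace.re := by
    rw [← re_trace_conjTranspose, conjTranspose_mul, conjTranspose_conjTranspose]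
  have hquad : ∀ t : ℝ, 0 ≤ (Aᴴ * A).trace.re * (t * t) + 2 * (Aᴴ * B).trace.re * t +
      (Bᴴ * B).trace.re := fun t => by
    have h := re_trace_nonneg (posSemidef_conjTranspose_mul_self (t • A + B))
    simp only [conjTranspose_add, conjTranspose_smul, star_trivial, Matrix.add_mul,
      Matrix.mul_add, Matrix.smul_mul, Matrix.mul_smul, trace_add, trace_smul, Complex.add_re,
      Complex.smul_re, smul_eq_mul, hsymm] at h
    linarith
  have h := discrim_le_zero hquad
  rw [discrim] at h
  linarith

theorem re_trace_conjTranspose_mul_self_le [DecidableEq n] {K : Matrix m n ℂ} (hK : Kᴴ * K ≤ 1)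
    (B : Matrix n l ℂ) : ((K * B)ᴴ * (K * B)).trace.re ≤ (Bᴴ * B).trace.re := by
  refine re_trace_mono (le_iff.2 ?_)
  have h := (le_iff.1 hK).conjTranspose_mul_mul_same B
  simpa only [Matrix.mul_sub, Matrix.sub_mul, conjTranspose_mul, Matrix.mul_assoc,
    Matrix.one_mul] using h

theorem re_trace_contraction_mul_le [DecidableEq n] {k : Type*} [Fintype k] [DecidableEq k]
    {K : Matrix m n ℂ} {L : Matrix m k ℂ} (hK : Kᴴ * K ≤ 1) (hL : Lᴴ * L ≤ 1)
    {B : Matrix n l ℂ} {C : Matrix k l ℂ} {t : ℝ} (hB : (Bᴴ * B).trace.re ≤ t)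
    (hC : (Cᴴ * C).trace.re ≤ t) : ((L * C)ᴴ * (K * B)).trace.re ≤ t := by
  have ht : 0 ≤ t := (re_trace_nonneg (posSemidef_conjTranspose_mul_self B)).trans hB
  refine abs_le_of_sq_le_sq' ?_ ht |>.2
  calc ((L * C)ᴴ * (K * B)).trace.re ^ 2
      ≤ ((L * C)ᴴ * (L * C)).trace.re * ((K * B)ᴴ * (K * B)).trace.re :=
        re_trace_conjTranspose_mul_sq_le _ _
    _ ≤ t * t := mul_le_mul ((re_trace_conjTranspose_mul_self_le hL C).trans hC)
        ((re_trace_conjTranspose_mul_self_le hK B).trans hB)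
        (re_trace_nonneg (posSemidef_conjTranspose_mul_self _)) ht
    _ = t ^ 2 := (sq t).symm

theorem re_trace_mul_nonneg {A B : Matrix n n ℂ} (hA : A.PosSemidef) (hB : B.PosSemidef) :
    0 ≤ (A * B).trace.re := by
  classical
  obtain ⟨C, rfl⟩ := CStarAlgebra.nonneg_iff_eq_star_mul_self.1 hB.nonneg
  rw [← Matrix.mul_assoc, trace_mul_comm, ← Matrix.mul_assoc]
  exact re_trace_nonneg (hA.mul_mul_conjTranspose_same C)

end TraceInequalities

section Fidelity

variable {m n : Type*} [Fintype m] [Fintype n] [DecidableEq n]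

theorem exists_polar {P : Matrix n n ℂ} (hP : P.PosSemidef) {R : Matrix m n ℂ}
    (hR : Rᴴ * R = P * P) : ∃ K : Matrix m n ℂ, K * P = R ∧ Kᴴ * R = P ∧ Kᴴ * K ≤ 1 := by
  obtain ⟨J, hJ, hJP, hPJP, hJPJ⟩ := exists_pinv_of_posSemidef hP
  refine ⟨R * J, ?_, ?_, ?_⟩
  · have hker : R * (1 - J * P) = 0 := by
      rw [← conjTranspose_mul_self_mul_eq_zero, hR, Matrix.mul_assoc, Matrix.mul_sub,
        Matrix.mul_one, ← Matrix.mul_assoc P J, hPJP, sub_self, Matrix.mul_zero]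
    rw [Matrix.mul_sub, Matrix.mul_one, sub_eq_zero, ← Matrix.mul_assoc] at hker
    exact hker.symm
  · rw [conjTranspose_mul, hJ, Matrix.mul_assoc, hR, ← Matrix.mul_assoc, hJP, hPJP]
  · have hidem : J * P * (J * P) = J * P := by rw [← Matrix.mul_assoc, hJPJ]
    have hherm : (J * P)ᴴ = J * P := by rw [conjTranspose_mul, hJ, hP.1, hJP]
    have hKK : (R * J)ᴴ * (R * J) = J * P := by
      calc (R * J)ᴴ * (R * J) = J * (Rᴴ * R) * J := by
            rw [conjTranspose_mul, hJ]
            simp only [Matrix.mul_assoc]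
        _ = J * P * (P * J) := by
            rw [hR]
            simp only [Matrix.mul_assoc]
        _ = J * P := by rw [← hJP, hidem]
    have hproj : 1 - J * P = (1 - J * P)ᴴ * (1 - J * P) := by
      rw [conjTranspose_sub, conjTranspose_one, hherm, Matrix.sub_mul, Matrix.mul_sub,
        Matrix.mul_sub, hidem]
      simp
    rw [le_iff, hKK, hproj]
    exact posSemidef_conjTranspose_mul_self _

theorem posSemidef_sqrt (A : Matrix n n ℂ) : (CFC.sqrt A).PosSemidef :=
  nonneg_iff_posSemidef.1 (CFC.sqrt_nonneg A)

theorem conjTranspose_sqrt (A : Matrix n n ℂ) : (CFC.sqrt A)ᴴ = CFC.sqrt A :=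
  (posSemidef_sqrt A).1

theorem sqrt_mul_sqrt {A : Matrix n n ℂ} (hA : A.PosSemidef) : CFC.sqrt A * CFC.sqrt A = A :=
  CFC.sqrt_mul_sqrt_self A hA.nonneg

theorem exists_polar_sqrt (R : Matrix m n ℂ) : ∃ K : Matrix m n ℂ,
    K * CFC.sqrt (Rᴴ * R) = R ∧ Kᴴ * R = CFC.sqrt (Rᴴ * R) ∧ Kᴴ * K ≤ 1 :=
  exists_polar (posSemidef_sqrt _) (sqrt_mul_sqrt (posSemidef_conjTranspose_mul_self R)).symm

theorem re_trace_contraction_mul_le_traceNorm {K L : Matrix m n ℂ} (hK : Kᴴ * K ≤ 1)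
    (hL : Lᴴ * L ≤ 1) (A : Matrix n n ℂ) : (Lᴴ * K * A).trace.re ≤ traceNorm A := by
  obtain ⟨J, hJ, -, hJ1⟩ := exists_polar_sqrt A
  set T := CFC.sqrt (Aᴴ * A)
  set B := CFC.sqrt T
  have hBh : Bᴴ = B := conjTranspose_sqrt T
  have hBT : Bᴴ * B = T := by rw [hBh, sqrt_mul_sqrt (posSemidef_sqrt _)]
  have hcycl : (Lᴴ * K * A).trace = ((L * B)ᴴ * (K * (J * B))).trace := by
    calc (Lᴴ * K * A).trace = (Lᴴ * K * J * B * B).trace := by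
          rw [← hJ, ← hBT, hBh]
          simp only [Matrix.mul_assoc]
      _ = ((L * B)ᴴ * (K * (J * B))).trace := by
          rw [trace_mul_comm, conjTranspose_mul, hBh]
          simp only [Matrix.mul_assoc]
  have hB : (Bᴴ * B).trace.re ≤ traceNorm A := by rw [hBT, traceNorm]
  rw [hcycl]
  exact re_trace_contraction_mul_le hK hL ((re_trace_conjTranspose_mul_self_le hJ1 B).trans hB) hB

/- One half of Uhlmann's theorem. -/
theorem re_trace_conjTranspose_mul_le_fidelity (R S : Matrix m n ℂ) :
    (Rᴴ * S).trace.re ≤ fidelity (Rᴴ * R) (Sᴴ * S) := by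
  obtain ⟨K, hK, -, hK1⟩ := exists_polar_sqrt R
  obtain ⟨L, hL, -, hL1⟩ := exists_polar_sqrt S
  set P := CFC.sqrt (Rᴴ * R)
  set Q := CFC.sqrt (Sᴴ * S)
  have hQh : Qᴴ = Q := conjTranspose_sqrt _
  calc (Rᴴ * S).trace.re = (Sᴴ * R).trace.re := by
        rw [← re_trace_conjTranspose, conjTranspose_mul, conjTranspose_conjTranspose]
    _ = (Lᴴ * K * (P * Q)).trace.re := by
        rw [← hK, ← hL, conjTranspose_mul, hQh, Matrix.mul_assoc, trace_mul_comm]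
        simp only [Matrix.mul_assoc]
    _ ≤ fidelity (Rᴴ * R) (Sᴴ * S) := re_trace_contraction_mul_le_traceNorm hK1 hL1 _

/- One half of Alberti's theorem: the left-hand side is in fact the infimum over `G`. -/
theorem fidelity_sq_le {ρ τ G : Matrix n n ℂ} (hρ : ρ.PosSemidef) (hτ : τ.PosSemidef)
    (hG : G.PosDef) : fidelity ρ τ ^ 2 ≤ (ρ * G⁻¹).trace.re * (τ * G).trace.re := by
  have hPP := sqrt_mul_sqrt hρ
  have hQQ := sqrt_mul_sqrt hτ
  have hCC := sqrt_mul_sqrt hG.posSemidef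
  have hPh := conjTranspose_sqrt ρ
  have hQh := conjTranspose_sqrt τ
  have hCh := conjTranspose_sqrt G
  obtain ⟨J, -, hJ, hJ1⟩ := exists_polar_sqrt (CFC.sqrt ρ * CFC.sqrt τ)
  set P := CFC.sqrt ρ
  set Q := CFC.sqrt τ
  set C := CFC.sqrt G
  have hC : IsUnit C.det := by
    have hGdet := (isUnit_iff_isUnit_det _).1 hG.isUnit
    rw [← hCC, det_mul] at hGdet
    exact isUnit_of_mul_isUnit_left hGdet
  have hfid : fidelity ρ τ = ((C⁻¹ * P)ᴴ * (C * (Q * Jᴴ))).trace.re := by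
    rw [fidelity, traceNorm, ← hJ, trace_mul_comm, conjTranspose_mul, conjTranspose_nonsing_inv,
      hPh, hCh, Matrix.mul_assoc P, Matrix.mul_assoc P,
      nonsing_inv_mul_cancel_left _ _ hC]
  have hleft : ((C⁻¹ * P)ᴴ * (C⁻¹ * P)).trace.re = (ρ * G⁻¹).trace.re := by
    rw [conjTranspose_mul, conjTranspose_nonsing_inv, hPh, hCh, ← hCC, Matrix.mul_inv_rev, ← hPP,
      Matrix.mul_assoc P P, trace_mul_comm P (P * _)]
    simp only [Matrix.mul_assoc]
  have hright : ((C * (Q * Jᴴ))ᴴ * (C * (Q * Jᴴ))).trace.re ≤ (τ * G).trace.re := by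
    calc ((C * (Q * Jᴴ))ᴴ * (C * (Q * Jᴴ))).trace.re
        = ((J * (C * Q)ᴴ)ᴴ * (J * (C * Q)ᴴ)).trace.re := by
          rw [trace_mul_comm]
          simp only [conjTranspose_mul, conjTranspose_conjTranspose, Matrix.mul_assoc]
      _ ≤ (((C * Q)ᴴ)ᴴ * (C * Q)ᴴ).trace.re := re_trace_conjTranspose_mul_self_le hJ1 _
      _ = (τ * G).trace.re := by
          rw [conjTranspose_conjTranspose, conjTranspose_mul, hQh, hCh, ← hCC, ← hQQ,
            Matrix.mul_assoc, trace_mul_comm]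
          simp only [Matrix.mul_assoc]
  rw [hfid, ← hleft]
  exact (re_trace_conjTranspose_mul_sq_le _ _).trans (mul_le_mul_of_nonneg_left hright
    (re_trace_nonneg (posSemidef_conjTranspose_mul_self _)))

theorem fidelity_nonneg (ρ τ : Matrix n n ℂ) : 0 ≤ fidelity ρ τ :=
  re_trace_nonneg (posSemidef_sqrt _)

end Fidelity

section Compactness

variable {m n : Type*} [Fintype m] [Fintype n]

theorem isClosed_posSemidef {n : Type*} [Finite n] :
    IsClosed {M : Matrix n n ℂ | M.PosSemidef} := by
  have := Fintype.ofFinite n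
  simp only [posSemidef_iff_dotProduct_mulVec, Set.ofPred_and, Set.ofPred_forall, IsHermitian]
  exact (isClosed_eq (by fun_prop) continuous_id).inter
    (isClosed_iInter fun x => isClosed_le continuous_const (by fun_prop))

theorem re_trace_conjTranspose_mul_self (S : Matrix m n ℂ) :
    (Sᴴ * S).trace.re = ∑ j, ∑ i, ‖S i j‖ ^ 2 := by
  simp only [trace, diag_apply, mul_apply, conjTranspose_apply, Complex.star_def,
    Complex.conj_mul', Complex.re_sum, ← Complex.ofReal_pow, Complex.ofReal_re]

theorem isCompact_re_trace_conjTranspose_mul_self_le (t : ℝ) :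
    IsCompact {S : Matrix m n ℂ | (Sᴴ * S).trace.re ≤ t} := by
  refine (isCompact_univ_pi fun _ => isCompact_univ_pi fun _ =>
    isCompact_closedBall (0 : ℂ) (√t)).of_isClosed_subset
    (isClosed_le (Complex.continuous_re.comp (by fun_prop)) continuous_const) ?_
  intro (S : Matrix m n ℂ) hS i _ j _
  have hentry : ‖S i j‖ ^ 2 ≤ t :=
    calc ‖S i j‖ ^ 2 ≤ ∑ k, ‖S k j‖ ^ 2 :=
          Finset.single_le_sum (f := fun k => ‖S k j‖ ^ 2) (fun _ _ => sq_nonneg _)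
            (Finset.mem_univ i)
      _ ≤ ∑ l, ∑ k, ‖S k l‖ ^ 2 :=
          Finset.single_le_sum (f := fun l => ∑ k, ‖S k l‖ ^ 2)
            (fun _ _ => Finset.sum_nonneg fun _ _ => sq_nonneg _) (Finset.mem_univ j)
      _ ≤ t := re_trace_conjTranspose_mul_self S ▸ hS
  simpa using Real.le_sqrt_of_sq_le hentry

theorem isCompact_posSemidef_re_trace_le (c : ℝ) :
    IsCompact {M : Matrix n n ℂ | M.PosSemidef ∧ M.trace.re ≤ c} := by
  classical
  convert (isCompact_re_trace_conjTranspose_mul_self_le (m := n) (n := n) c).image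
    (f := fun S => Sᴴ * S) (by fun_prop)
  ext M
  constructor
  · rintro ⟨hM, hc⟩
    obtain ⟨S, rfl⟩ := CStarAlgebra.nonneg_iff_eq_star_mul_self.1 hM.nonneg
    exact ⟨S, hc, rfl⟩
  · rintro ⟨S, hS, rfl⟩
    exact ⟨posSemidef_conjTranspose_mul_self S, hS⟩

end Compactness

section Functionals

variable {n : Type*} [Fintype n]

theorem posSemidef_of_re_trace_mul_nonneg {M : Matrix n n ℂ} (hM : M.IsHermitian)
    (h : ∀ Q : Matrix n n ℂ, Q.PosSemidef → 0 ≤ (M * Q).trace.re) : M.PosSemidef := by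
  refine .of_dotProduct_mulVec_nonneg hM fun x => Complex.nonneg_iff.2
    ⟨?_, (hM.im_star_dotProduct_mulVec_self x).symm⟩
  simpa [mul_vecMulVec, trace_vecMulVec, dotProduct_comm] using
    h _ (posSemidef_vecMulVec_self_star x)

theorem exists_re_trace_mul_eq (φ : Matrix n n ℂ →ₗ[ℝ] ℝ) :
    ∃ W : Matrix n n ℂ, ∀ A, φ A = (W * A).trace.re := by
  classical
  set L : Matrix n n ℂ →ₗ[ℂ] ℂ := Module.Dual.extendRCLike φ
  refine ⟨of fun i j => L (single j i 1), fun A => ?_⟩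
  have hL : L A = (of (fun i j => L (single j i 1)) * A).trace := by
    conv_lhs => rw [matrix_eq_sum_single A]
    simp only [map_sum, trace, diag_apply, mul_apply, of_apply]
    rw [Finset.sum_comm]
    refine Finset.sum_congr rfl fun i _ => Finset.sum_congr rfl fun j _ => ?_
    rw [← mul_one (A j i), ← smul_eq_mul, ← smul_single, map_smul, smul_eq_mul, smul_eq_mul,
      mul_one, mul_comm]
  rw [← hL]
  simp [L, Module.Dual.extendRCLike_apply]

theorem exists_posSemidef_re_trace_mul_eq (φ : Matrix n n ℂ →ₗ[ℝ] ℝ)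
    (hφ : ∀ Q : Matrix n n ℂ, Q.PosSemidef → 0 ≤ φ Q) :
    ∃ W : Matrix n n ℂ, W.PosSemidef ∧ ∀ A, A.IsHermitian → φ A = (W * A).trace.re := by
  obtain ⟨V, hV⟩ := exists_re_trace_mul_eq φ
  have hφV : ∀ A, A.IsHermitian → φ A = (((2⁻¹ : ℝ) • (V + Vᴴ)) * A).trace.re := by
    intro A hA
    have hsymm : (Vᴴ * A).trace.re = (V * A).trace.re := by
      rw [← re_trace_conjTranspose, conjTranspose_mul, conjTranspose_conjTranspose, hA.eq,
        trace_mul_comm]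
    rw [hV, Matrix.smul_mul, trace_smul, Complex.smul_re, Matrix.add_mul, trace_add,
      Complex.add_re, hsymm, smul_eq_mul]
    ring
  have hherm : ((2⁻¹ : ℝ) • (V + Vᴴ)).IsHermitian := by
    rw [IsHermitian, conjTranspose_smul, conjTranspose_add, conjTranspose_conjTranspose,
      add_comm, star_trivial]
  exact ⟨_, posSemidef_of_re_trace_mul_nonneg hherm fun Q hQ => hφV Q hQ.1 ▸ hφ Q hQ, hφV⟩

end Functionals

section Lagrange

open scoped Pointwise in
theorem exists_nonneg_separating_of_concaveOn {V β : Type*} [AddCommGroup V] [Module ℝ V]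
    [TopologicalSpace V] [AddCommGroup β] [PartialOrder β] [IsOrderedAddMonoid β] [Module ℝ β]
    [PosSMulMono ℝ β] [TopologicalSpace β] [IsTopologicalAddGroup β] [ContinuousSMul ℝ β]
    [LocallyConvexSpace ℝ β] (hcone : IsClosed (Set.Ici (0 : β))) {K : Set V} (hK : IsCompact K)
    (hne : K.Nonempty) {G : V → β} (hG : ContinuousOn G K) (hGc : ConcaveOn ℝ K G) {x : β}
    (hx : ∀ z ∈ K, ¬ x ≤ G z) :
    ∃ φ : StrongDual ℝ β, (∀ p, 0 ≤ p → 0 ≤ φ p) ∧ ∃ u < φ x, ∀ z ∈ K, φ (G z) ≤ u := by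
  have hmem : ∀ p, p ∈ -Set.Ici (0 : β) + G '' K ↔ ∃ z ∈ K, p ≤ G z := by
    intro p
    simp only [Set.mem_add, Set.mem_neg, Set.mem_Ici, Set.mem_image]
    constructor
    · rintro ⟨a, ha, _, ⟨z, hz, rfl⟩, rfl⟩
      exact ⟨z, hz, add_le_of_nonpos_left (neg_nonneg.1 ha)⟩
    · rintro ⟨z, hz, hp⟩
      exact ⟨p - G z, by simpa using hp, G z, ⟨z, hz, rfl⟩, sub_add_cancel _ _⟩
  have hconv : Convex ℝ (-Set.Ici (0 : β) + G '' K) := by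
    intro p hp q hq s t hs ht hst
    rw [hmem] at *
    obtain ⟨⟨z, hz, hpz⟩, w, hw, hqw⟩ := And.intro hp hq
    exact ⟨s • z + t • w, hGc.1 hz hw hs ht hst,
      (add_le_add (smul_le_smul_of_nonneg_left hpz hs) (smul_le_smul_of_nonneg_left hqw ht)).trans
        (hGc.2 hz hw hs ht hst)⟩
  obtain ⟨φ, u, hu, hux⟩ := geometric_hahn_banach_closed_point hconv
    (hcone.neg.add_right_of_isCompact (hK.image_of_continuousOn hG))
    (show x ∉ _ from fun h => let ⟨z, hz, hxz⟩ := (hmem x).1 h; hx z hz hxz)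
  refine ⟨φ, fun p hp => ?_, u, hux, fun z hz => (hu _ ((hmem _).2 ⟨z, hz, le_rfl⟩)).le⟩
  by_contra! hneg
  obtain ⟨z, hz⟩ := hne
  obtain ⟨k, hk⟩ := exists_nat_gt ((u - φ (G z)) / -φ p)
  have hbound := hu (G z - (k : ℝ) • p)
    ((hmem _).2 ⟨z, hz, sub_le_self _ (smul_nonneg k.cast_nonneg hp)⟩)
  rw [div_lt_iff₀ (neg_pos.2 hneg)] at hk
  rw [map_sub, map_smul, smul_eq_mul] at hbound
  linarith

theorem exists_posSemidef_multiplier {V n : Type*} [AddCommGroup V] [Module ℝ V]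
    [TopologicalSpace V] [Fintype n] {K : Set V} (hK : IsCompact K)
    {F : V → Matrix n n ℂ} (hF : ContinuousOn F K) (hFc : ConcaveOn ℝ K F)
    (hFh : ∀ z ∈ K, (F z).IsHermitian) {f : V → ℝ} (hf : ContinuousOn f K)
    (hfc : ConcaveOn ℝ K f) {z₀ : V} (hz₀ : z₀ ∈ K) (hF₀ : 0 ≤ F z₀) {h : ℝ}
    (hlt : ∀ z ∈ K, 0 ≤ F z → f z < h) :
    ∃ W : Matrix n n ℂ, W.PosSemidef ∧ ∃ g < h, ∀ z ∈ K, (W * F z).trace.re + f z ≤ g := by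
  have : LocallyConvexSpace ℝ (Matrix n n ℂ) :=
    inferInstanceAs (LocallyConvexSpace ℝ (n → n → ℂ))
  have hcone : IsClosed (Set.Ici (0 : Matrix n n ℂ × ℝ)) := by
    rw [← Prod.mk_zero_zero, ← Set.Ici_prod_Ici]
    simpa only [Set.Ici, nonneg_iff_posSemidef] using isClosed_posSemidef.prod isClosed_Ici
  obtain ⟨φ, hφ, u, hu, hφK⟩ := exists_nonneg_separating_of_concaveOn hcone hK ⟨z₀, hz₀⟩
    (G := fun z => (F z, f z)) (hF.prodMk hf)
    ⟨hFc.1, fun _ hv _ hw _ _ hs ht hst =>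
      ⟨hFc.2 hv hw hs ht hst, hfc.2 hv hw hs ht hst⟩⟩
    (x := (0, h)) fun z hz hle => (hlt z hz hle.1).not_ge hle.2
  obtain ⟨W, hW, hφW⟩ := exists_posSemidef_re_trace_mul_eq
    (φ.toLinearMap ∘ₗ LinearMap.inl ℝ (Matrix n n ℂ) ℝ) fun Q hQ => hφ _ ⟨hQ.nonneg, le_rfl⟩
  set τ := φ (0, 1)
  have hφ_eq : ∀ z ∈ K, φ (F z, f z) = (W * F z).trace.re + f z * τ := fun z hz => by
    rw [← hφW _ (hFh z hz), ← smul_eq_mul, ← map_smul]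
    simp [← map_add]
  have hx_eq : φ (0, h) = h * τ := by
    rw [← smul_eq_mul, ← map_smul]
    simp
  rw [hx_eq] at hu
  have hτ : 0 < τ := by
    have hW₀ := re_trace_mul_nonneg hW (nonneg_iff_posSemidef.1 hF₀)
    have hle := hφ_eq z₀ hz₀ ▸ hφK z₀ hz₀
    have hf₀ := hlt z₀ hz₀ hF₀
    nlinarith [hφ (0, 1) ⟨le_rfl, zero_le_one⟩]
  refine ⟨τ⁻¹ • W, hW.smul (inv_nonneg.2 hτ.le), u / τ, (div_lt_iff₀ hτ).2 hu, fun z hz => ?_⟩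
  rw [Matrix.smul_mul, trace_smul, Complex.smul_re, smul_eq_mul, le_div_iff₀ hτ, add_mul,
    mul_right_comm, inv_mul_cancel₀ hτ.ne', one_mul, ← hφ_eq z hz]
  exact hφK z hz

end Lagrange

section Concavity

variable {m n : Type*} [Fintype m] [Fintype n]

theorem convexOn_conjTranspose_mul_self {n : Type*} [Finite n] :
    ConvexOn ℝ Set.univ fun S : Matrix m n ℂ => Sᴴ * S := by
  refine ⟨convex_univ, fun A _ B _ s t hs ht hst => le_iff.2 ?_⟩
  have hgap : s • (Aᴴ * A) + t • (Bᴴ * B) - (s • A + t • B)ᴴ * (s • A + t • B)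
      = (s * t) • ((A - B)ᴴ * (A - B)) := by
    obtain rfl : t = 1 - s := by linarith
    simp only [conjTranspose_add, conjTranspose_sub, conjTranspose_smul, star_trivial,
      Matrix.add_mul, Matrix.mul_add, Matrix.sub_mul, Matrix.mul_sub, Matrix.smul_mul,
      Matrix.mul_smul]
    module
  simpa only [hgap] using (posSemidef_conjTranspose_mul_self (A - B)).smul (mul_nonneg hs ht)

theorem convexOn_re_trace_conjTranspose_mul_self :
    ConvexOn ℝ Set.univ fun S : Matrix m n ℂ => (Sᴴ * S).trace.re := by
  refine ⟨convex_univ, fun A hA B hB s t hs ht hst => ?_⟩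
  simpa using re_trace_mono (convexOn_conjTranspose_mul_self.2 hA hB hs ht hst)

theorem convex_posSemidef_re_trace_le (c : ℝ) :
    Convex ℝ {M : Matrix n n ℂ | M.PosSemidef ∧ M.trace.re ≤ c} := by
  rintro A ⟨hA, hAc⟩ B ⟨hB, hBc⟩ s t hs ht hst
  refine ⟨(hA.smul hs).add (hB.smul ht), ?_⟩
  simpa using convex_Iic c hAc hBc hs ht hst

theorem concaveOn_one_kronecker_sub_conjTranspose_mul_self {a b : Type*} [Finite a]
    [DecidableEq a] [Finite b] :
    ConcaveOn ℝ Set.univ fun z : Matrix m (a × b) ℂ × Matrix b b ℂ =>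
      (1 : Matrix a a ℂ) ⊗ₖ z.2 - z.1ᴴ * z.1 := by
  refine ⟨convex_univ, fun y _ z _ s t hs ht hst => ?_⟩
  have h := convexOn_conjTranspose_mul_self.2 (Set.mem_univ y.1) (Set.mem_univ z.1) hs ht hst
  simp only [Prod.fst_add, Prod.snd_add, Prod.smul_fst, Prod.smul_snd, kronecker_add,
    kronecker_smul, smul_sub]
  calc _ = s • (1 : Matrix a a ℂ) ⊗ₖ y.2 + t • (1 : Matrix a a ℂ) ⊗ₖ z.2
        - (s • (y.1ᴴ * y.1) + t • (z.1ᴴ * z.1)) := by abel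
    _ ≤ _ := sub_le_sub_left h _

end Concavity

section PartialTrace

variable {a b : Type*} [Fintype a]

/-- The partial trace over the first factor. -/
def traceLeft (W : Matrix (a × b) (a × b) ℂ) : Matrix b b ℂ :=
  of fun e e' => ∑ x, W (x, e) (x, e')

theorem posSemidef_traceLeft {W : Matrix (a × b) (a × b) ℂ} (hW : W.PosSemidef) :
    (traceLeft W).PosSemidef := by
  have hsum : traceLeft W = ∑ x, W.submatrix (Prod.mk x) (Prod.mk x) := by
    ext e e'
    simp [traceLeft, Matrix.sum_apply]
  rw [hsum]
  exact posSemidef_sum _ fun x _ => hW.submatrix _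

theorem traceLeft_smul (r : ℝ) (W : Matrix (a × b) (a × b) ℂ) :
    traceLeft (r • W) = r • traceLeft W := by
  ext e e'
  simp [traceLeft, Finset.mul_sum]

theorem trace_mul_one_kronecker [DecidableEq a] [Fintype b] (W : Matrix (a × b) (a × b) ℂ)
    (ω : Matrix b b ℂ) :
    (W * ((1 : Matrix a a ℂ) ⊗ₖ ω)).trace = (traceLeft W * ω).trace := by
  simp only [trace, diag_apply, mul_apply, traceLeft, of_apply, Fintype.sum_prod_type,
    kroneckerMap_apply, one_apply, Finset.sum_mul, ite_mul, one_mul, zero_mul, mul_ite, mul_zero,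
    Finset.sum_ite_irrel, Finset.sum_const_zero, Finset.sum_ite_eq', Finset.mem_univ, if_true]
  rw [Finset.sum_comm]
  exact Finset.sum_congr rfl fun _ _ => Finset.sum_comm

theorem smul_le_smul_one_of_re_trace_mul_le {n : Type*} [Fintype n] [DecidableEq n]
    {V : Matrix n n ℂ} (hV : V.IsHermitian) {c κ : ℝ} (hc : 0 ≤ c)
    (h : ∀ ω : Matrix n n ℂ, ω.PosSemidef → ω.trace.re ≤ c → (V * ω).trace.re ≤ κ) :
    c • V ≤ κ • (1 : Matrix n n ℂ) := by
  refine le_iff.2 (posSemidef_of_re_trace_mul_nonneg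
    ((isHermitian_one.smul (star_trivial κ)).sub (hV.smul (star_trivial c))) fun Q hQ => ?_)
  rw [Matrix.sub_mul, trace_sub, Matrix.smul_mul, Matrix.smul_mul, trace_smul, trace_smul,
    Matrix.one_mul, Complex.sub_re, Complex.smul_re, Complex.smul_re, smul_eq_mul, smul_eq_mul,
    sub_nonneg]
  rcases (re_trace_nonneg hQ).eq_or_lt with h0 | h0
  · have hQ0 : Q = 0 := hQ.trace_eq_zero_iff.1
      (Complex.ext h0.symm (Complex.nonneg_iff.1 hQ.trace_nonneg).2.symm)
    simp [hQ0]
  · have hω := h ((c / Q.trace.re) • Q) (hQ.smul (by positivity)) (by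
      rw [trace_smul, Complex.smul_re, smul_eq_mul, div_mul_cancel₀ _ h0.ne'])
    rwa [Matrix.mul_smul, trace_smul, Complex.smul_re, smul_eq_mul, div_mul_eq_mul_div,
      div_le_iff₀ h0] at hω

end PartialTrace

section Duality

variable {a b : Type*} [Fintype a] [DecidableEq a] [Fintype b] [DecidableEq b]

/-- The subnormalized operators whose conditional min-entropy is at least `-log c`. -/
def highEntropySet (c : ℝ) : Set (Matrix (a × b) (a × b) ℂ) :=
  {τ | τ.PosSemidef ∧ τ.trace.re ≤ 1 ∧
    ∃ ω : Matrix b b ℂ, ω.PosSemidef ∧ ω.trace.re ≤ c ∧ τ ≤ (1 : Matrix a a ℂ) ⊗ₖ ω}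

/-- A witness that every `τ ∈ highEntropySet c` satisfies `fidelity ρ τ ^ 2 < t`. The operator `W`
is the Lagrange multiplier of the constraint `τ ≤ 1 ⊗ ω`, and `r` balances it against the
constraint on the trace of `τ`. -/
def HasDualCertificate (ρ : Matrix (a × b) (a × b) ℂ) (c t : ℝ) : Prop :=
  ∃ W : Matrix (a × b) (a × b) ℂ, W.PosSemidef ∧ ∃ r : ℝ, 0 < r ∧ c • traceLeft W ≤ 1 ∧
    (1 + r) * (ρ * (1 + r • W)⁻¹).trace.re < t

theorem re_trace_mul_inv_one_add_smul_specOp {n : Type*} [Fintype n] [DecidableEq n]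
    (ρ : Matrix n n ℂ) {U : Matrix n n ℂ} (hU : U ∈ unitaryGroup n ℂ) {w : n → ℝ} (hw : 0 ≤ w)
    {r : ℝ} (hr : 0 ≤ r) :
    (ρ * (1 + r • specOp U w)⁻¹).trace.re = ∑ i, measureDist ρ U i * (1 + r * w i)⁻¹ := by
  rw [← specOp_one hU, ← specOp_smul, ← specOp_add, specOp_inv hU, re_trace_mul_specOp]
  · simp
  · intro i
    have := mul_nonneg hr (hw i)
    simp only [Pi.add_apply, Pi.one_apply, Pi.smul_apply, smul_eq_mul]
    positivity

theorem exists_pos_sum_mul_inv_add_sq_le {κ : Type*} [Fintype κ] {p w : κ → ℝ}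
    (hp : ∀ k, 0 ≤ p k) (hp1 : ∑ k, p k ≤ 1) (hw : ∀ k, 0 ≤ w k) {δ : ℝ} (hδ : 0 < δ) :
    ∃ s > 0, ∑ k, p k * (s + w k)⁻¹ ^ 2 ≤ 1 ∧ s - δ ≤ s * ∑ k, p k * (s + w k)⁻¹ ^ 2 := by
  set H : ℝ → ℝ := fun s => ∑ k, p k * (s + w k)⁻¹ ^ 2
  rcases le_or_gt (H δ) 1 with hle | hgt
  · refine ⟨δ, hδ, hle, ?_⟩
    rw [sub_self]
    exact mul_nonneg hδ.le (Finset.sum_nonneg fun k _ => mul_nonneg (hp k) (sq_nonneg _))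
  · have hcont : ContinuousOn H (Set.Icc δ (max δ 1)) :=
      continuousOn_finsetSum _ fun k _ => continuousOn_const.mul
        (((continuousOn_id.add continuousOn_const).inv₀ fun s hs =>
          (add_pos_of_pos_of_nonneg (hδ.trans_le hs.1) (hw k)).ne').pow 2)
    have hmax : H (max δ 1) ≤ 1 := by
      refine (Finset.sum_le_sum fun k _ => mul_le_of_le_one_right (hp k) ?_).trans hp1
      have hone : 1 ≤ max δ 1 + w k := le_add_of_le_of_nonneg (le_max_right _ _) (hw k)
      exact pow_le_one₀ (inv_nonneg.2 (zero_le_one.trans hone)) (inv_le_one_of_one_le₀ hone)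
    obtain ⟨s, hs, hs1⟩ := intermediate_value_Icc' (le_max_left _ _) hcont ⟨hmax, hgt.le⟩
    refine ⟨s, hδ.trans_le hs.1, hs1.le, ?_⟩
    change s - δ ≤ s * H s
    rw [hs1]
    linarith

theorem exists_lagrange_multiplier {n : Type*} [Fintype n] (R : Matrix n (a × b) ℂ) {c h : ℝ}
    (hc : 0 ≤ c)
    (hlt : ∀ τ ∈ highEntropySet c, fidelity (Rᴴ * R) τ < h) :
    ∃ W : Matrix (a × b) (a × b) ℂ, W.PosSemidef ∧ ∃ g < 2 * h,
      ∀ (S : Matrix n (a × b) ℂ) (ω : Matrix b b ℂ), (Sᴴ * S).trace.re ≤ 1 →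
        ω.PosSemidef → ω.trace.re ≤ c →
        2 * (Rᴴ * S).trace.re - (W * (Sᴴ * S)).trace.re + (traceLeft W * ω).trace.re ≤ g := by
  have hconv : Convex ℝ ({S : Matrix n (a × b) ℂ | (Sᴴ * S).trace.re ≤ 1} ×ˢ
      {ω : Matrix b b ℂ | ω.PosSemidef ∧ ω.trace.re ≤ c}) := by
    have hS := convexOn_re_trace_conjTranspose_mul_self (m := n) (n := a × b) |>.convex_le 1
    simp only [Set.mem_univ, true_and] at hS
    exact hS.prod (convex_posSemidef_re_trace_le c)
  have hcont : Continuous fun z : Matrix n (a × b) ℂ × Matrix b b ℂ =>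
      (1 : Matrix a a ℂ) ⊗ₖ z.2 - z.1ᴴ * z.1 := by
    refine .sub (continuous_matrix fun i j => ?_) (by fun_prop)
    simp only [kroneckerMap_apply]
    fun_prop
  have hobjective : ConcaveOn ℝ ({S : Matrix n (a × b) ℂ | (Sᴴ * S).trace.re ≤ 1} ×ˢ
      {ω : Matrix b b ℂ | ω.PosSemidef ∧ ω.trace.re ≤ c}) fun z => 2 * (Rᴴ * z.1).trace.re := by
    refine ⟨hconv, fun y _ z _ s t _ _ _ => le_of_eq ?_⟩
    simp [Matrix.mul_add]
    ring
  obtain ⟨W, hW, g, hg, hle⟩ := exists_posSemidef_multiplier (h := 2 * h) (z₀ := (0, 0))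
    ((isCompact_re_trace_conjTranspose_mul_self_le 1).prod (isCompact_posSemidef_re_trace_le c))
    hcont.continuousOn
    (concaveOn_one_kronecker_sub_conjTranspose_mul_self.subset (Set.subset_univ _) hconv)
    (fun z hz => (PosSemidef.one.kronecker hz.2.1).1.sub
      (posSemidef_conjTranspose_mul_self z.1).1)
    (Continuous.continuousOn (by fun_prop)) hobjective ⟨by simp, .zero, by simpa using hc⟩
    (by simp) fun z hz hslack => mul_lt_mul_of_pos_left
      ((re_trace_conjTranspose_mul_le_fidelity R z.1).trans_lt (hlt _
        ⟨posSemidef_conjTranspose_mul_self _, hz.1, z.2, hz.2.1, hz.2.2, sub_nonneg.1 hslack⟩))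
      two_pos
  refine ⟨W, hW, g, hg, fun S ω hS hω hωc => ?_⟩
  have h := hle (S, ω) ⟨hS, hω, hωc⟩
  rw [Matrix.mul_sub, trace_sub, trace_mul_one_kronecker, Complex.sub_re] at h
  linarith

theorem sum_measureDist_add_le_of_lagrange {n : Type*} [Fintype n] {R : Matrix n (a × b) ℂ}
    {U : Matrix (a × b) (a × b) ℂ} (hU : U ∈ unitaryGroup (a × b) ℂ) {w y : a × b → ℝ} {g : ℝ}
    {V : Matrix b b ℂ} {ω : Matrix b b ℂ}
    (hle : ∀ S : Matrix n (a × b) ℂ, (Sᴴ * S).trace.re ≤ 1 →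
      2 * (Rᴴ * S).trace.re - (specOp U w * (Sᴴ * S)).trace.re + (V * ω).trace.re ≤ g)
    (hy : ∑ k, measureDist (Rᴴ * R) U k * y k ^ 2 ≤ 1) :
    ∑ k, measureDist (Rᴴ * R) U k * (2 * y k - w k * y k ^ 2) + (V * ω).trace.re ≤ g := by
  set ρ := Rᴴ * R with hρ
  set Y := specOp U y
  have hY : Yᴴ = Y := isHermitian_specOp U y
  have hsquare : (R * Y)ᴴ * (R * Y) = Y * (ρ * Y) := by
    rw [conjTranspose_mul, hY, Matrix.mul_assoc, ← Matrix.mul_assoc Rᴴ]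
  have hconstraint : (Y * (ρ * Y)).trace.re = ∑ k, measureDist ρ U k * y k ^ 2 := by
    rw [trace_mul_comm, Matrix.mul_assoc, specOp_mul_specOp hU, re_trace_mul_specOp]
    simp only [Pi.mul_apply, sq]
  have hpenalty : (specOp U w * (Y * (ρ * Y))).trace.re
      = ∑ k, measureDist ρ U k * (w k * y k ^ 2) := by
    rw [trace_mul_comm, Matrix.mul_assoc, trace_mul_comm, Matrix.mul_assoc, Matrix.mul_assoc,
      specOp_mul_specOp hU, specOp_mul_specOp hU, re_trace_mul_specOp]
    refine Finset.sum_congr rfl fun k _ => ?_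
    simp only [Pi.mul_apply]
    ring
  have h := hle (R * Y) (by rw [hsquare, hconstraint]; exact hy)
  rw [hsquare, hpenalty, ← Matrix.mul_assoc, ← hρ, re_trace_mul_specOp, Finset.mul_sum,
    ← Finset.sum_sub_distrib] at h
  refine le_of_eq_of_le ?_ h
  congr 1
  exact Finset.sum_congr rfl fun k _ => by ring

theorem hasDualCertificate_of_sum_lt {ρ U : Matrix (a × b) (a × b) ℂ}
    (hU : U ∈ unitaryGroup (a × b) ℂ) {w : a × b → ℝ} (hw : 0 ≤ w) {c s κ t : ℝ} (hs : 0 < s)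
    (hκ : 0 < κ) (hV : c • traceLeft (specOp U w) ≤ κ • (1 : Matrix b b ℂ))
    (ht : (s + κ) * ∑ k, measureDist ρ U k * (s + w k)⁻¹ < t) : HasDualCertificate ρ c t := by
  refine ⟨κ⁻¹ • specOp U w, (posSemidef_specOp U hw).smul (inv_nonneg.2 hκ.le), κ / s,
    div_pos hκ hs, ?_, ?_⟩
  · rw [traceLeft_smul, smul_comm]
    simpa [smul_smul, hκ.ne'] using smul_le_smul_of_nonneg_left hV (inv_nonneg.2 hκ.le)
  · refine lt_of_eq_of_lt ?_ ht
    rw [smul_smul, re_trace_mul_inv_one_add_smul_specOp _ hU hw (by positivity),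
      Finset.mul_sum, Finset.mul_sum]
    refine Finset.sum_congr rfl fun k _ => ?_
    have := (add_pos_of_pos_of_nonneg hs (hw k)).ne'
    field_simp

/- The operators `S = R (s + W)⁻¹` maximize the Lagrangian at a fixed multiplier `s` of the
constraint `tr (SᴴS) ≤ 1`. -/
theorem hasDualCertificate_of_lagrange {n : Type*} [Fintype n] {R : Matrix n (a × b) ℂ}
    (hR : IsState (Rᴴ * R)) {c h g : ℝ} (hc : 0 ≤ c) (hg : g < 2 * h)
    {W : Matrix (a × b) (a × b) ℂ} (hW : W.PosSemidef)
    (hle : ∀ (S : Matrix n (a × b) ℂ) (ω : Matrix b b ℂ), (Sᴴ * S).trace.re ≤ 1 →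
      ω.PosSemidef → ω.trace.re ≤ c →
      2 * (Rᴴ * S).trace.re - (W * (Sᴴ * S)).trace.re + (traceLeft W * ω).trace.re ≤ g) :
    HasDualCertificate (Rᴴ * R) c (h ^ 2) := by
  have hVh := (posSemidef_traceLeft hW).1
  obtain ⟨U, hU, w, hw, rfl⟩ := exists_specOp_of_posSemidef hW
  set p := measureDist (Rᴴ * R) U
  have hp : ∀ k, 0 ≤ p k := measureDist_nonneg hR.1 U
  have hp1 : ∑ k, p k ≤ 1 := by rw [sum_measureDist _ hU, hR.2, Complex.one_re]
  obtain ⟨δ, hδ, hδg⟩ : ∃ δ > 0, g + 2 * δ < 2 * h := ⟨(2 * h - g) / 4, by linarith, by linarith⟩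
  obtain ⟨s, hs, hsq, hsδ⟩ := exists_pos_sum_mul_inv_add_sq_le hp hp1 hw hδ
  have hsw : ∀ k, 0 < s + w k := fun k => add_pos_of_pos_of_nonneg hs (hw k)
  set A := ∑ k, p k * (s + w k)⁻¹
  have hA : 0 ≤ A := Finset.sum_nonneg fun k _ => mul_nonneg (hp k) (inv_nonneg.2 (hsw k).le)
  have hobjective : ∑ k, p k * (2 * (s + w k)⁻¹ - w k * (s + w k)⁻¹ ^ 2)
      = A + s * ∑ k, p k * (s + w k)⁻¹ ^ 2 := by
    simp only [A, Finset.mul_sum, ← Finset.sum_add_distrib]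
    refine Finset.sum_congr rfl fun k _ => ?_
    linear_combination (-(p k * (s + w k)⁻¹)) * inv_mul_cancel₀ (hsw k).ne'
  have hbound : ∀ ω : Matrix b b ℂ, ω.PosSemidef → ω.trace.re ≤ c →
      (traceLeft (specOp U w) * ω).trace.re ≤ g + δ - A - s := fun ω hω hωc => by
    have h := sum_measureDist_add_le_of_lagrange hU (hle · ω · hω hωc) hsq
    rw [hobjective] at h
    linarith
  have hnonneg : 0 ≤ g + δ - A - s := by simpa using hbound 0 .zero (by simpa using hc)
  refine hasDualCertificate_of_sum_lt hU hw hs (κ := g + 2 * δ - A - s) (by linarith)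
    (smul_le_smul_one_of_re_trace_mul_le hVh hc
      fun ω hω hωc => (hbound ω hω hωc).trans (by linarith)) ?_
  change (s + (g + 2 * δ - A - s)) * A < h ^ 2
  nlinarith [sq_nonneg (g + 2 * δ - 2 * A)]

theorem exists_mem_highEntropySet_or_hasDualCertificate {ρ : Matrix (a × b) (a × b) ℂ}
    (hρ : IsState ρ) {c : ℝ} (hc : 0 ≤ c) (h : ℝ) :
    (∃ τ ∈ highEntropySet c, h ≤ fidelity ρ τ) ∨ HasDualCertificate ρ c (h ^ 2) := by
  refine or_iff_not_imp_left.2 fun hno => ?_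
  push Not at hno
  obtain ⟨R, rfl⟩ := CStarAlgebra.nonneg_iff_eq_star_mul_self.1 hρ.1.nonneg
  obtain ⟨W, hW, g, hg, hle⟩ := exists_lagrange_multiplier R hc hno
  exact hasDualCertificate_of_lagrange hρ hc hg hW hle

theorem fidelity_sq_lt_of_hasDualCertificate {ρ : Matrix (a × b) (a × b) ℂ} (hρ : ρ.PosSemidef)
    {c t : ℝ} (hc : 0 < c) (hcert : HasDualCertificate ρ c t) {τ : Matrix (a × b) (a × b) ℂ}
    (hτ : τ ∈ highEntropySet c) : fidelity ρ τ ^ 2 < t := by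
  obtain ⟨W, hW, r, hr, hV, hlt⟩ := hcert
  obtain ⟨hτ0, hτ1, ω, hω, hωc, hτω⟩ := hτ
  have hVω : (traceLeft W * ω).trace.re ≤ 1 := by
    have h := re_trace_mul_nonneg (le_iff.1 hV) hω
    rw [Matrix.sub_mul, trace_sub, Complex.sub_re, Matrix.one_mul, Matrix.smul_mul, trace_smul,
      Complex.smul_re, smul_eq_mul] at h
    exact le_of_mul_le_mul_left (by linarith) hc
  have hWτ : (W * τ).trace.re ≤ (traceLeft W * ω).trace.re := by
    have h := re_trace_mul_nonneg hW (le_iff.1 hτω)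
    rwa [Matrix.mul_sub, trace_sub, trace_mul_one_kronecker, Complex.sub_re, sub_nonneg] at h
  set G := 1 + r • W
  have hG : G.PosDef := PosDef.one.add_posSemidef (hW.smul hr.le)
  have hGτ : (τ * G).trace.re ≤ 1 + r := by
    rw [trace_mul_comm, Matrix.add_mul, Matrix.one_mul, trace_add, Complex.add_re, Matrix.smul_mul,
      trace_smul, Complex.smul_re, smul_eq_mul]
    nlinarith [hVω.trans' hWτ]
  have hinv := re_trace_mul_nonneg hρ hG.inv.posSemidef
  calc fidelity ρ τ ^ 2 ≤ (ρ * G⁻¹).trace.re * (τ * G).trace.re := fidelity_sq_le hρ hτ0 hG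
    _ ≤ (ρ * G⁻¹).trace.re * (1 + r) := mul_le_mul_of_nonneg_left hGτ hinv
    _ < t := by rwa [mul_comm]

end Duality

section Tensor

variable {a b a' b' : Type*} [Fintype a] [Fintype a']

theorem kronecker_le_one {m n : Type*} [Finite m] [DecidableEq m] [Finite n] [DecidableEq n]
    {A : Matrix m m ℂ} {B : Matrix n n ℂ} (hA : 0 ≤ A) (hA1 : A ≤ 1) (hB1 : B ≤ 1) :
    A ⊗ₖ B ≤ 1 := by
  have hsplit : 1 - A ⊗ₖ B = (1 - A) ⊗ₖ (1 : Matrix n n ℂ) + A ⊗ₖ (1 - B) := by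
    rw [← one_kronecker_one]
    ext p q
    simp only [Matrix.sub_apply, Matrix.add_apply, kroneckerMap_apply]
    ring
  rw [le_iff, hsplit]
  exact ((le_iff.1 hA1).kronecker .one).add ((nonneg_iff_posSemidef.1 hA).kronecker (le_iff.1 hB1))

theorem traceLeft_kronecker_submatrix (W : Matrix (a × b) (a × b) ℂ)
    (W' : Matrix (a' × b') (a' × b') ℂ) :
    traceLeft ((W ⊗ₖ W').submatrix (Equiv.prodProdProdComm a a' b b')
      (Equiv.prodProdProdComm a a' b b')) = traceLeft W ⊗ₖ traceLeft W' := by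
  ext e e'
  simp only [traceLeft, of_apply, submatrix_apply, Equiv.prodProdProdComm_apply,
    kroneckerMap_apply, Fintype.sum_prod_type, Finset.sum_mul_sum]

theorem trace_submatrix_equiv {m n : Type*} [Fintype m] [Fintype n] (M : Matrix n n ℂ)
    (e : m ≃ n) : (M.submatrix e e).trace = M.trace :=
  Equiv.sum_comp e fun k => M k k

theorem trace_submatrix_mul_inv_one_add_smul {m n : Type*} [Fintype m] [DecidableEq m]
    [Fintype n] [DecidableEq n] (M N : Matrix n n ℂ) (r : ℝ) (e : m ≃ n) :
    (M.submatrix e e * (1 + r • N.submatrix e e)⁻¹).trace = (M * (1 + r • N)⁻¹).trace := by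
  have hsub : 1 + r • N.submatrix e e = (1 + r • N).submatrix e e := by
    rw [submatrix_add, Pi.add_apply, Pi.add_apply, submatrix_one_equiv]
    rfl
  rw [hsub, inv_submatrix_equiv, submatrix_mul_equiv, trace_submatrix_equiv]

theorem measureDist_kronecker {m n : Type*} [Fintype m] [Fintype n] {ρ : Matrix m m ℂ}
    (hρ : ρ.IsHermitian) (ρ' : Matrix n n ℂ) (U : Matrix m m ℂ) (U' : Matrix n n ℂ) (k : m × n) :
    measureDist (ρ ⊗ₖ ρ') (U ⊗ₖ U') k = measureDist ρ U k.1 * measureDist ρ' U' k.2 := by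
  have him : ((Uᴴ * ρ * U) k.1 k.1).im = 0 :=
    Complex.conj_eq_iff_im.1 ((isHermitian_conjTranspose_mul_mul U hρ).apply k.1 k.1)
  simp only [measureDist, conjTranspose_kronecker, ← mul_kronecker_mul, kroneckerMap_apply,
    Complex.mul_re, him, zero_mul, sub_zero]

variable [Fintype b] [Fintype b'] [DecidableEq a] [DecidableEq b] [DecidableEq a'] [DecidableEq b']

theorem HasDualCertificate.kronecker {ρ : Matrix (a × b) (a × b) ℂ}
    {ρ' : Matrix (a' × b') (a' × b') ℂ} (hρ : IsState ρ) (hρ' : IsState ρ') {c c' t t' : ℝ}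
    (hc : 0 ≤ c) (ht : t ≤ 1) (ht' : t' ≤ 1) (hcert : HasDualCertificate ρ c t)
    (hcert' : HasDualCertificate ρ' c' t') :
    HasDualCertificate ((ρ ⊗ₖ ρ').submatrix (Equiv.prodProdProdComm a a' b b')
      (Equiv.prodProdProdComm a a' b b')) (c * c' / 3) (1 - (1 - t) * (1 - t')) := by
  obtain ⟨W, hW, r, hr, hV, hlt⟩ := hcert
  obtain ⟨W', hW', s, hs, hV', hlt'⟩ := hcert'
  have hV0 : 0 ≤ c • traceLeft W := ((posSemidef_traceLeft hW).smul hc).nonneg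
  have hVV' := kronecker_le_one hV0 hV hV'
  obtain ⟨U, hU, w, hw, rfl⟩ := exists_specOp_of_posSemidef hW
  obtain ⟨U', hU', w', hw', rfl⟩ := exists_specOp_of_posSemidef hW'
  rw [re_trace_mul_inv_one_add_smul_specOp ρ hU hw hr.le] at hlt
  rw [re_trace_mul_inv_one_add_smul_specOp ρ' hU' hw' hs.le] at hlt'
  obtain ⟨R, hR, hle⟩ := exists_sum_sum_mul_inv_le (measureDist_nonneg hρ.1 U)
    (measureDist_nonneg hρ'.1 U') (by rw [sum_measureDist _ hU, hρ.2, Complex.one_re])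
    (by rw [sum_measureDist _ hU', hρ'.2, Complex.one_re]) hw hw' hr hs (hlt.le.trans ht)
    (hlt'.le.trans ht')
  refine ⟨(3 : ℝ) • (specOp U w ⊗ₖ specOp U' w').submatrix (Equiv.prodProdProdComm a a' b b')
    (Equiv.prodProdProdComm a a' b b'), ((hW.kronecker hW').submatrix _).smul (by norm_num),
    R, hR, ?_, ?_⟩
  · rw [traceLeft_smul, traceLeft_kronecker_submatrix, smul_smul, div_mul_cancel₀ _ three_ne_zero]
    rwa [smul_kronecker, kronecker_smul, smul_smul] at hVV'
  · have hsum : ((ρ ⊗ₖ ρ') * (1 + (R * 3) • (specOp U w ⊗ₖ specOp U' w'))⁻¹).trace.re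
        = ∑ k, ∑ l, measureDist ρ U k * measureDist ρ' U' l * (1 + 3 * R * (w k * w' l))⁻¹ := by
      rw [specOp_kronecker, re_trace_mul_inv_one_add_smul_specOp _ (kronecker_mem_unitary hU hU')
        (fun k => mul_nonneg (hw k.1) (hw' k.2)) (by positivity), Fintype.sum_prod_type]
      simp only [measureDist_kronecker hρ.1.1, mul_comm R]
    rw [smul_smul, trace_submatrix_mul_inv_one_add_smul, hsum]
    refine hle.trans_lt ?_
    nlinarith

end Tensor

section Ampliation

variable {n a b : Type*} [DecidableEq b]

/-- The operator `N ⊗ 1` on a system with basis `n` that is identified with the composite of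
subsystems with bases `a` and `b` through `p ↦ (keep p, discard p)`, as in `partialTrace`, to which
it is adjoint. -/
def ampliation (keep : n → a) (discard : n → b) (N : Matrix a a ℂ) : Matrix n n ℂ :=
  (N ⊗ₖ (1 : Matrix b b ℂ)).submatrix (fun p => (keep p, discard p)) fun p => (keep p, discard p)

variable {keep : n → a} {discard : n → b}

theorem ampliation_apply (N : Matrix a a ℂ) (p q : n) :
    ampliation keep discard N p q =
      if discard p = discard q then N (keep p) (keep q) else 0 := by
  simp [ampliation, one_apply]

theorem trace_partialTrace_mul [Fintype n] [Fintype a] [DecidableEq a] (M : Matrix n n ℂ)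
    (N : Matrix a a ℂ) :
    (partialTrace keep discard M * N).trace = (M * ampliation keep discard N).trace := by
  have hcomm (f : a → a → n → n → ℂ) :
      ∑ s, ∑ t, ∑ p, ∑ q, f s t p q = ∑ p, ∑ q, ∑ s, ∑ t, f s t p q := by
    simp_rw [fun s => Finset.sum_comm (s := Finset.univ) (t := Finset.univ)
      (f := fun t p => ∑ q, f s t p q)]
    rw [Finset.sum_comm]
    refine Finset.sum_congr rfl fun p _ => ?_
    simp_rw [fun s => Finset.sum_comm (s := Finset.univ) (t := Finset.univ)
      (f := fun t q => f s t p q)]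
    exact Finset.sum_comm
  simp only [trace, diag_apply, mul_apply, partialTrace, of_apply, Finset.sum_mul,
    ampliation_apply, ite_mul, zero_mul, mul_ite, mul_zero]
  rw [hcomm]
  refine Finset.sum_congr rfl fun p _ => Finset.sum_congr rfl fun q _ => ?_
  simp [ite_and, Finset.sum_ite_irrel, eq_comm]

theorem ampliation_add (M N : Matrix a a ℂ) :
    ampliation keep discard (M + N) = ampliation keep discard M + ampliation keep discard N := by
  rw [ampliation, add_kronecker, submatrix_add]
  rfl

theorem ampliation_smul (r : ℝ) (N : Matrix a a ℂ) :
    ampliation keep discard (r • N) = r • ampliation keep discard N := by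
  rw [ampliation, smul_kronecker, submatrix_smul]
  rfl

theorem posSemidef_ampliation [Finite a] [Finite b] {N : Matrix a a ℂ} (hN : N.PosSemidef) :
    (ampliation keep discard N).PosSemidef :=
  (hN.kronecker .one).submatrix _

theorem ampliation_mono [Finite a] [Finite b] {M N : Matrix a a ℂ} (h : M ≤ N) :
    ampliation keep discard M ≤ ampliation keep discard N := by
  rw [← sub_add_cancel N M, ampliation_add]
  exact le_add_of_nonneg_left (posSemidef_ampliation (le_iff.1 h)).nonneg

theorem ampliation_one [DecidableEq n] [DecidableEq a]
    (h : Function.Injective fun p => (keep p, discard p)) :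
    ampliation keep discard 1 = 1 := by
  rw [ampliation, one_kronecker_one, submatrix_one _ h]

theorem ampliation_inv [Fintype n] [DecidableEq n] [Fintype a] [DecidableEq a] [Finite b]
    (h : Function.Bijective fun p => (keep p, discard p)) (N : Matrix a a ℂ) :
    ampliation keep discard N⁻¹ = (ampliation keep discard N)⁻¹ := by
  have := Fintype.ofFinite b
  have hinv := inv_submatrix_equiv (N ⊗ₖ (1 : Matrix b b ℂ)) (.ofBijective _ h) (.ofBijective _ h)
  rw [inv_kronecker, inv_one] at hinv
  exact hinv.symm

end Ampliation

section Marginal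

variable {a b b' d : Type*} [Fintype a] [DecidableEq d] {keep : b' → b} {discard : b' → d}

theorem traceLeft_ampliation (W : Matrix (a × b) (a × b) ℂ) :
    traceLeft (ampliation (fun p : a × b' => (p.1, keep p.2)) (fun p => discard p.2) W)
      = ampliation keep discard (traceLeft W) := by
  ext e e'
  simp only [traceLeft, of_apply, ampliation_apply, Finset.sum_ite_irrel, Finset.sum_const_zero]

variable [DecidableEq a] [Fintype b] [DecidableEq b] [Fintype b'] [DecidableEq b'] [Finite d]

theorem HasDualCertificate.of_partialTrace (h : Function.Bijective fun e => (keep e, discard e))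
    {ρ : Matrix (a × b') (a × b') ℂ} {c t : ℝ}
    (hcert : HasDualCertificate
      (partialTrace (fun p => (p.1, keep p.2)) (fun p => discard p.2) ρ) c t) :
    HasDualCertificate ρ c t := by
  obtain ⟨W, hW, r, hr, hV, hlt⟩ := hcert
  have hbij : Function.Bijective fun p : a × b' => ((p.1, keep p.2), discard p.2) :=
    ((Equiv.prodAssoc a b d).symm.bijective.comp (Function.bijective_id.prodMap h))
  refine ⟨ampliation (fun p => (p.1, keep p.2)) (fun p => discard p.2) W,
    posSemidef_ampliation hW, r, hr, ?_, ?_⟩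
  · rw [traceLeft_ampliation, ← ampliation_smul, ← ampliation_one h.1]
    exact ampliation_mono hV
  · rwa [← ampliation_smul, ← ampliation_one hbij.1, ← ampliation_add, ← ampliation_inv hbij,
      ← trace_partialTrace_mul]

end Marginal

section Marginals

variable {n a b : Type*} [Fintype n] [DecidableEq a] [DecidableEq b] {keep : n → a}
  {discard : n → b}

theorem isHermitian_partialTrace {M : Matrix n n ℂ} (hM : M.IsHermitian) :
    (partialTrace keep discard M).IsHermitian := by
  refine IsHermitian.ext fun s t => ?_
  simp only [partialTrace, of_apply, star_sum, apply_ite star, hM.apply, star_zero]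
  rw [Finset.sum_comm]
  refine Finset.sum_congr rfl fun p _ => Finset.sum_congr rfl fun q _ => if_congr ?_ rfl rfl
  tauto

theorem posSemidef_partialTrace [Finite a] [Finite b] {M : Matrix n n ℂ} (hM : M.PosSemidef) :
    (partialTrace keep discard M).PosSemidef := by
  have := Fintype.ofFinite a
  refine posSemidef_of_re_trace_mul_nonneg (isHermitian_partialTrace hM.1) fun N hN => ?_
  rw [trace_partialTrace_mul]
  exact re_trace_mul_nonneg hM (posSemidef_ampliation hN)

theorem eq_kronecker_submatrix_of_trace_mul {a b a' b' : Type*} [Fintype a] [Fintype b]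
    [Fintype a'] [Fintype b'] {M : Matrix ((a × a') × (b × b')) ((a × a') × (b × b')) ℂ}
    {N : Matrix (a × b) (a × b) ℂ} {N' : Matrix (a' × b') (a' × b') ℂ}
    (h : ∀ (A : Matrix (a × b) (a × b) ℂ) (B : Matrix (a' × b') (a' × b') ℂ),
      (M * (A ⊗ₖ B).submatrix (Equiv.prodProdProdComm a a' b b')
        (Equiv.prodProdProdComm a a' b b')).trace = (N * A).trace * (N' * B).trace) :
    M = (N ⊗ₖ N').submatrix (Equiv.prodProdProdComm a a' b b')
      (Equiv.prodProdProdComm a a' b b') := by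
  classical
  ext ⟨⟨x, x'⟩, y, y'⟩ ⟨⟨z, z'⟩, w, w'⟩
  have hsingle := h (single (z, w) (x, y) 1) (single (z', w') (x', y') 1)
  rw [single_kronecker_single, submatrix_single_equiv] at hsingle
  simpa [trace_mul_single] using hsingle

end Marginals

section Product

variable {m : ℕ} {X E : Fin m → Type*}

theorem productState_apply_of_eq_one [∀ i, DecidableEq (X i)] [∀ i, DecidableEq (E i)]
    {G : ∀ i, Matrix (X i × E i) (X i × E i) ℂ} {s : Finset (Fin m)} (hG : ∀ k ∉ s, G k = 1)
    (p q : (∀ i, X i) × (∀ i, E i)) [Decidable (∀ k ∉ s, p.1 k = q.1 k ∧ p.2 k = q.2 k)] :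
    productState G p q = if ∀ k ∉ s, p.1 k = q.1 k ∧ p.2 k = q.2 k then
      ∏ k ∈ s, G k (p.1 k, p.2 k) (q.1 k, q.2 k) else 0 := by
  have hcompl : ∏ k ∈ sᶜ, G k (p.1 k, p.2 k) (q.1 k, q.2 k)
      = if ∀ k ∉ s, p.1 k = q.1 k ∧ p.2 k = q.2 k then 1 else 0 := by
    rw [Finset.prod_congr rfl fun k hk => by rw [hG k (Finset.mem_compl.1 hk), one_apply],
      Finset.prod_ite_zero, Finset.prod_const_one]
    simp only [Finset.mem_compl, Prod.mk.injEq]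
  rw [productState, of_apply, ← Finset.prod_mul_prod_compl s, hcompl, mul_ite, mul_one, mul_zero]

variable [∀ i, Fintype (X i)] [∀ i, Fintype (E i)]

theorem sum_prod_pair_apply (f : ∀ i, X i × E i → ℂ) :
    ∑ p : (∀ i, X i) × (∀ i, E i), ∏ i, f i (p.1 i, p.2 i) = ∏ i, ∑ r, f i r := by
  rw [Finset.prod_univ_sum, Fintype.piFinset_univ,
    ← Equiv.sum_comp (Equiv.arrowProdEquivProdArrow (Fin m) X E)]
  rfl

theorem productState_mul (ρ G : ∀ i, Matrix (X i × E i) (X i × E i) ℂ) :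
    productState ρ * productState G = productState fun i => ρ i * G i := by
  ext p q
  simp only [mul_apply, productState, of_apply, ← Finset.prod_mul_distrib]
  exact sum_prod_pair_apply fun i r => ρ i (p.1 i, p.2 i) r * G i r (q.1 i, q.2 i)

theorem trace_productState (ρ : ∀ i, Matrix (X i × E i) (X i × E i) ℂ) :
    (productState ρ).trace = ∏ i, (ρ i).trace :=
  sum_prod_pair_apply fun i r => ρ i r r

theorem trace_productState_mul_of_eq_one {ρ G : ∀ i, Matrix (X i × E i) (X i × E i) ℂ}
    [∀ i, DecidableEq (X i)] [∀ i, DecidableEq (E i)] (hρ : ∀ i, (ρ i).trace = 1)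
    {s : Finset (Fin m)} (hG : ∀ k ∉ s, G k = 1) :
    (productState ρ * productState G).trace = ∏ k ∈ s, (ρ k * G k).trace := by
  rw [productState_mul, trace_productState, ← Finset.prod_subset s.subset_univ]
  intro k _ hk
  rw [hG k hk, Matrix.mul_one, hρ]

theorem isState_productState {ρ : ∀ i, Matrix (X i × E i) (X i × E i) ℂ}
    (hρ : ∀ i, IsState (ρ i)) : IsState (productState ρ) := by
  classical
  choose C hC using fun i => CStarAlgebra.nonneg_iff_eq_star_mul_self.1 (hρ i).1.nonneg
  have hstar : (productState C)ᴴ = productState fun i => (C i)ᴴ := by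
    ext p q
    simp only [conjTranspose_apply, productState, of_apply, star_prod]
  have hfactor : productState ρ = (productState C)ᴴ * productState C := by
    rw [hstar, productState_mul]
    exact congrArg productState (funext hC)
  refine ⟨hfactor ▸ posSemidef_conjTranspose_mul_self _, ?_⟩
  rw [trace_productState, Finset.prod_eq_one fun i _ => (hρ i).2]

variable [∀ i, DecidableEq (X i)] [∀ i, DecidableEq (E i)]

theorem partialTrace_productState (v : Fin m) {ρ : ∀ i, Matrix (X i × E i) (X i × E i) ℂ}
    (hρ : ∀ i, (ρ i).trace = 1) :
    partialTrace (fun p : (∀ k, X k) × (∀ k, E k) => (p.1 v, p.2 v))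
      (fun p => ((fun k : {k : Fin m // k ≠ v} => p.1 k),
        (fun k : {k : Fin m // k ≠ v} => p.2 k))) (productState ρ) = ρ v := by
  refine Matrix.ext_iff_trace_mul_right.2 fun N => ?_
  set G : ∀ k, Matrix (X k × E k) (X k × E k) ℂ := Function.update (fun _ => 1) v N
  have hGv : G v = N := Function.update_self ..
  have hG : ∀ k ∉ ({v} : Finset (Fin m)), G k = 1 := fun k hk =>
    Function.update_of_ne (by simpa using hk) ..
  have hampl : ampliation (fun p : (∀ k, X k) × (∀ k, E k) => (p.1 v, p.2 v))
      (fun p => ((fun k : {k : Fin m // k ≠ v} => p.1 k),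
        (fun k : {k : Fin m // k ≠ v} => p.2 k))) N = productState G := by
    ext p q
    rw [ampliation_apply, productState_apply_of_eq_one hG, Finset.prod_singleton, hGv]
    refine if_congr ?_ rfl rfl
    simp only [Prod.mk.injEq, funext_iff, Subtype.forall, Finset.mem_singleton, forall_and]
  rw [trace_partialTrace_mul, hampl, trace_productState_mul_of_eq_one hρ hG, Finset.prod_singleton,
    hGv]

theorem partialTrace_pairState_productState {i j : Fin m} (hij : i ≠ j)
    {ρ : ∀ i, Matrix (X i × E i) (X i × E i) ℂ} (hρ : ∀ i, (ρ i).trace = 1) :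
    partialTrace (fun p : (X i × X j) × (∀ k, E k) => (p.1, (p.2 i, p.2 j)))
      (fun p => fun k : {k : Fin m // k ≠ i ∧ k ≠ j} => p.2 k) (pairState (productState ρ) i j)
      = (ρ i ⊗ₖ ρ j).submatrix (Equiv.prodProdProdComm (X i) (X j) (E i) (E j))
        (Equiv.prodProdProdComm (X i) (X j) (E i) (E j)) := by
  refine eq_kronecker_submatrix_of_trace_mul fun A B => ?_
  set G : ∀ k, Matrix (X k × E k) (X k × E k) ℂ :=
    Function.update (Function.update (fun _ => 1) j B) i A
  have hGi : G i = A := Function.update_self ..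
  have hGj : G j = B := by simp [G, hij.symm]
  have hG : ∀ k ∉ ({i, j} : Finset (Fin m)), G k = 1 := fun k hk => by
    simp only [Finset.mem_insert, Finset.mem_singleton, not_or] at hk
    simp [G, hk]
  rw [trace_partialTrace_mul, pairState, trace_partialTrace_mul]
  have hampl : ampliation (fun p : (∀ k, X k) × (∀ k, E k) => ((p.1 i, p.1 j), p.2))
      (fun p => fun k : {k : Fin m // k ≠ i ∧ k ≠ j} => p.1 k)
      (ampliation (fun p : (X i × X j) × (∀ k, E k) => (p.1, (p.2 i, p.2 j)))
        (fun p => fun k : {k : Fin m // k ≠ i ∧ k ≠ j} => p.2 k)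
        ((A ⊗ₖ B).submatrix (Equiv.prodProdProdComm (X i) (X j) (E i) (E j))
          (Equiv.prodProdProdComm (X i) (X j) (E i) (E j)))) = productState G := by
    ext p q
    rw [ampliation_apply, ampliation_apply, ← ite_and, productState_apply_of_eq_one hG,
      Finset.prod_pair hij, hGi, hGj]
    refine if_congr ?_ rfl rfl
    simp only [funext_iff, Subtype.forall, Finset.mem_insert, Finset.mem_singleton, not_or,
      forall_and]
  rw [hampl, trace_productState_mul_of_eq_one hρ hG, Finset.prod_pair hij, hGi, hGj]

theorem bijective_pair_apply {ι : Type*} {F : ι → Type*} {i j : ι} (hij : i ≠ j) :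
    Function.Bijective fun e : ∀ k, F k =>
      ((e i, e j), fun k : {k : ι // k ≠ i ∧ k ≠ j} => e k) := by
  classical
  refine ⟨fun e e' h => funext fun k => ?_, fun ⟨⟨y, y'⟩, f⟩ => ⟨fun k =>
    if hi : k = i then hi ▸ y else if hj : k = j then hj ▸ y' else f ⟨k, hi, hj⟩, ?_⟩⟩
  · simp only [Prod.mk.injEq] at h
    rcases eq_or_ne k i with rfl | hi
    · exact h.1.1
    rcases eq_or_ne k j with rfl | hj
    · exact h.1.2
    exact congrFun h.2 ⟨k, hi, hj⟩
  · exact Prod.ext (by simp [hij.symm]) (funext fun k => by simp [k.2.1, k.2.2])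

theorem HasDualCertificate.pairState_productState {i j : Fin m} (hij : i ≠ j)
    {ρ : ∀ i, Matrix (X i × E i) (X i × E i) ℂ} (hρ : ∀ i, IsState (ρ i)) {c c' t t' : ℝ}
    (hc : 0 ≤ c) (ht : t ≤ 1) (ht' : t' ≤ 1) (hcert : HasDualCertificate (ρ i) c t)
    (hcert' : HasDualCertificate (ρ j) c' t') :
    HasDualCertificate (pairState (productState ρ) i j) (c * c' / 3)
      (1 - (1 - t) * (1 - t')) := by
  refine .of_partialTrace (bijective_pair_apply hij) ?_
  rw [partialTrace_pairState_productState hij fun k => (hρ k).2]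
  exact hcert.kronecker (hρ i) (hρ j) hc ht ht' hcert'

end Product

section MinEntropy

variable {a b : Type*} [Fintype a] [DecidableEq a] [Fintype b]

theorem coe_le_neg_log2_iff {β t : ℝ} : (β : EReal) ≤ -log2 t ↔ t ≤ 2 ^ (-β) := by
  rw [EReal.le_neg, log2, ← EReal.coe_neg]
  split_ifs with ht
  · exact iff_of_true bot_le (ht.trans (Real.rpow_pos_of_pos two_pos _).le)
  · rw [EReal.coe_le_coe_iff, Real.logb_le_iff_le_rpow one_lt_two (not_le.1 ht)]

theorem coe_lt_neg_log2_iff {β t : ℝ} : (β : EReal) < -log2 t ↔ t < 2 ^ (-β) := by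
  rw [EReal.lt_neg_comm, log2, ← EReal.coe_neg]
  split_ifs with ht
  · exact iff_of_true (EReal.bot_lt_coe _) (ht.trans_lt (Real.rpow_pos_of_pos two_pos _))
  · rw [EReal.coe_lt_coe_iff, Real.logb_lt_iff_lt_rpow one_lt_two (not_le.1 ht)]

theorem le_minEntropy {ρ : Matrix (a × b) (a × b) ℂ} {ω : Matrix b b ℂ} {β : ℝ}
    (hω : ω.PosSemidef) (hle : ρ ≤ (1 : Matrix a a ℂ) ⊗ₖ ω) (htr : ω.trace.re ≤ 2 ^ (-β)) :
    (β : EReal) ≤ minEntropy ρ := by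
  refine coe_le_neg_log2_iff.2 (le_trans (csInf_le ⟨0, ?_⟩ ⟨ω, hω, le_iff.1 hle, rfl⟩) htr)
  rintro _ ⟨σ, hσ, -, rfl⟩
  exact re_trace_nonneg hσ

theorem le_re_trace_smul_one {n : Type*} [Fintype n] [DecidableEq n] {A : Matrix n n ℂ}
    (hA : A.PosSemidef) : A ≤ A.trace.re • (1 : Matrix n n ℂ) := by
  obtain ⟨U, hU, w, hw, rfl⟩ := exists_specOp_of_posSemidef hA
  have htr : (specOp U w).trace.re = ∑ i, w i := by
    rw [specOp, trace_mul_comm, ← Matrix.mul_assoc, ← star_eq_conjTranspose,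
      mem_unitaryGroup_iff'.1 hU, Matrix.one_mul, trace_diagonal, Complex.re_sum]
    rfl
  have hsplit : (∑ i, w i) • (1 : Matrix n n ℂ) - specOp U w
      = specOp U fun i => ∑ j, w j - w i := by
    rw [sub_eq_iff_eq_add, ← specOp_one hU, ← specOp_smul, ← specOp_add]
    congr 1
    ext i
    simp
  rw [htr, le_iff, hsplit]
  exact posSemidef_specOp U fun i =>
    sub_nonneg.2 (Finset.single_le_sum (fun j _ => hw j) (Finset.mem_univ i))

theorem exists_kronecker_of_lt_minEntropy {ρ : Matrix (a × b) (a × b) ℂ} {β : ℝ}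
    (hρ : ρ.PosSemidef) (h : (β : EReal) < minEntropy ρ) :
    ∃ ω : Matrix b b ℂ, ω.PosSemidef ∧ ρ ≤ (1 : Matrix a a ℂ) ⊗ₖ ω ∧ ω.trace.re ≤ 2 ^ (-β) := by
  classical
  have hle : ρ ≤ (1 : Matrix a a ℂ) ⊗ₖ (ρ.trace.re • (1 : Matrix b b ℂ)) := by
    simpa only [kronecker_smul, one_kronecker_one] using le_re_trace_smul_one hρ
  have hne : {t : ℝ | ∃ ω : Matrix b b ℂ, ω.PosSemidef ∧
      ((1 : Matrix a a ℂ) ⊗ₖ ω - ρ).PosSemidef ∧ t = ω.trace.re}.Nonempty :=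
    ⟨_, _, PosSemidef.one.smul (re_trace_nonneg hρ), le_iff.1 hle, rfl⟩
  obtain ⟨_, ⟨ω, hω, hle, rfl⟩, hlt⟩ := exists_lt_of_csInf_lt hne (coe_lt_neg_log2_iff.1 h)
  exact ⟨ω, hω, le_iff.2 hle, hlt.le⟩

theorem cDist_le_iff {n : Type*} [Fintype n] [DecidableEq n] {ρ τ : Matrix n n ℂ} {ε : ℝ}
    (hε : 0 ≤ ε) : cDist ρ τ ≤ ε ↔ 1 - ε ^ 2 ≤ fidelity ρ τ ^ 2 := by
  rw [cDist, Real.sqrt_le_left hε, sub_le_comm]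

variable [DecidableEq b] {ε β : ℝ} {ρ : Matrix (a × b) (a × b) ℂ}

theorem le_smoothMinEntropy (hε : 0 ≤ ε) {τ : Matrix (a × b) (a × b) ℂ}
    (hτ : τ ∈ highEntropySet (2 ^ (-β))) (hfid : 1 - ε ^ 2 ≤ fidelity ρ τ ^ 2) :
    (β : EReal) ≤ smoothMinEntropy ε ρ := by
  obtain ⟨hτ0, hτ1, ω, hω, htr, hle⟩ := hτ
  exact le_iSup₂_of_le τ ⟨hτ0, (cDist_le_iff hε).2 hfid, hτ1⟩ (le_minEntropy hω hle htr)

theorem exists_mem_highEntropySet_of_lt_smoothMinEntropy (hε : 0 ≤ ε)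
    (h : (β : EReal) < smoothMinEntropy ε ρ) :
    ∃ τ ∈ highEntropySet (2 ^ (-β)), 1 - ε ^ 2 ≤ fidelity ρ τ ^ 2 := by
  rw [smoothMinEntropy] at h
  simp only [lt_iSup_iff] at h
  obtain ⟨τ, ⟨hτ0, hdist, hτ1⟩, hlt⟩ := h
  obtain ⟨ω, hω, hle, htr⟩ := exists_kronecker_of_lt_minEntropy hτ0 hlt
  exact ⟨τ, ⟨hτ0, hτ1, ω, hω, htr, hle⟩, (cDist_le_iff hε).1 hdist⟩

theorem hasDualCertificate_of_smoothMinEntropy_lt (hρ : IsState ρ) (hε : 0 ≤ ε)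
    (h : smoothMinEntropy ε ρ < β) : HasDualCertificate ρ (2 ^ (-β)) (1 - ε ^ 2) := by
  have hfar : ∀ τ ∈ highEntropySet (2 ^ (-β)), fidelity ρ τ ^ 2 < 1 - ε ^ 2 := fun τ hτ =>
    not_le.1 fun hfid => h.not_ge (le_smoothMinEntropy hε hτ hfid)
  have hc : (0 : ℝ) ≤ 2 ^ (-β) := (Real.rpow_pos_of_pos two_pos _).le
  have hε1 : 0 ≤ 1 - ε ^ 2 := (sq_nonneg _).trans
    (hfar 0 ⟨.zero, by simp, 0, .zero, by simpa using hc, by simp⟩).le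
  rw [← Real.sq_sqrt hε1]
  refine (exists_mem_highEntropySet_or_hasDualCertificate hρ hc _).resolve_left ?_
  rintro ⟨τ, hτ, hfid⟩
  exact (hfar τ hτ).not_ge ((Real.sqrt_le_left (fidelity_nonneg ρ τ)).1 hfid)

theorem smoothMinEntropy_pairState_le {m : ℕ} {X E : Fin m → Type*} [∀ i, Fintype (X i)]
    [∀ i, DecidableEq (X i)] [∀ i, Fintype (E i)] [∀ i, DecidableEq (E i)]
    {ρ : ∀ i, Matrix (X i × E i) (X i × E i) ℂ} (hρ : ∀ i, IsState (ρ i)) {ε β β' : ℝ}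
    (hε : 0 ≤ ε) {i j : Fin m} (hij : i ≠ j) (hi : smoothMinEntropy ε (ρ i) < β)
    (hj : smoothMinEntropy ε (ρ j) < β') :
    smoothMinEntropy (ε ^ 2) (pairState (productState ρ) i j) ≤
      (β + β' + Real.logb 2 3 : ℝ) := by
  by_contra! hlt
  obtain ⟨τ, hτ, hfid⟩ := exists_mem_highEntropySet_of_lt_smoothMinEntropy (sq_nonneg ε) hlt
  have hcert := (hasDualCertificate_of_smoothMinEntropy_lt (hρ i) hε hi).pairState_productState
    hij hρ (Real.rpow_pos_of_pos two_pos _).le (sub_le_self 1 (sq_nonneg ε))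
    (sub_le_self 1 (sq_nonneg ε)) (hasDualCertificate_of_smoothMinEntropy_lt (hρ j) hε hj)
  have hpow : (2 : ℝ) ^ (-(β + β' + Real.logb 2 3)) = 2 ^ (-β) * 2 ^ (-β') / 3 := by
    rw [neg_add, neg_add, Real.rpow_add two_pos, Real.rpow_add two_pos, Real.rpow_neg two_pos.le
      (Real.logb 2 3), Real.rpow_logb two_pos (by norm_num) three_pos, div_eq_mul_inv]
  rw [← hpow] at hcert
  have hfar := fidelity_sq_lt_of_hasDualCertificate
    (posSemidef_partialTrace (isState_productState hρ).1) (Real.rpow_pos_of_pos two_pos _) hcert hτ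
  refine (hfid.trans_lt hfar).ne ?_
  ring

end MinEntropy

section Isometry

variable {n n' : Type*} [Fintype n] [DecidableEq n] [Fintype n'] {V : Matrix n n' ℂ}

theorem trace_conj (hV : V * Vᴴ = 1) (M : Matrix n n ℂ) : (Vᴴ * M * V).trace = M.trace := by
  rw [Matrix.mul_assoc, trace_mul_comm, Matrix.mul_assoc, hV, Matrix.mul_one]

theorem conj_mul_conj (hV : V * Vᴴ = 1) (A B : Matrix n n ℂ) :
    Vᴴ * A * V * (Vᴴ * B * V) = Vᴴ * (A * B) * V := by
  calc Vᴴ * A * V * (Vᴴ * B * V) = Vᴴ * A * (V * Vᴴ) * B * V := by simp only [Matrix.mul_assoc]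
    _ = Vᴴ * (A * B) * V := by rw [hV, Matrix.mul_one, Matrix.mul_assoc Vᴴ]

variable [DecidableEq n']

theorem sqrt_conj (hV : V * Vᴴ = 1) {M : Matrix n n ℂ} (hM : M.PosSemidef) :
    CFC.sqrt (Vᴴ * M * V) = Vᴴ * CFC.sqrt M * V := by
  refine CFC.sqrt_unique ?_ ((posSemidef_sqrt M).conjTranspose_mul_mul_same V).nonneg
  rw [conj_mul_conj hV, sqrt_mul_sqrt hM]

theorem traceNorm_conj (hV : V * Vᴴ = 1) (A : Matrix n n ℂ) :
    traceNorm (Vᴴ * A * V) = traceNorm A := by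
  have hstar : (Vᴴ * A * V)ᴴ = Vᴴ * Aᴴ * V := by
    rw [conjTranspose_mul, conjTranspose_mul, conjTranspose_conjTranspose, Matrix.mul_assoc]
  rw [traceNorm, traceNorm, hstar, conj_mul_conj hV,
    sqrt_conj hV (posSemidef_conjTranspose_mul_self A), trace_conj hV]

theorem fidelity_conj (hV : V * Vᴴ = 1) {ρ τ : Matrix n n ℂ} (hρ : ρ.PosSemidef)
    (hτ : τ.PosSemidef) : fidelity (Vᴴ * ρ * V) (Vᴴ * τ * V) = fidelity ρ τ := by
  rw [fidelity, fidelity, sqrt_conj hV hρ, sqrt_conj hV hτ, conj_mul_conj hV, traceNorm_conj hV]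

theorem smoothMinEntropy_le_conj {a : Type*} [Fintype a] [DecidableEq a] (hV : V * Vᴴ = 1) {ε : ℝ}
    (hε : 0 ≤ ε) {ρ : Matrix (a × n) (a × n) ℂ} (hρ : ρ.PosSemidef) :
    smoothMinEntropy ε ρ ≤
      smoothMinEntropy ε (((1 : Matrix a a ℂ) ⊗ₖ V)ᴴ * ρ * ((1 : Matrix a a ℂ) ⊗ₖ V)) := by
  have hW : (1 : Matrix a a ℂ) ⊗ₖ V * ((1 : Matrix a a ℂ) ⊗ₖ V)ᴴ = 1 := by
    rw [conjTranspose_kronecker, ← mul_kronecker_mul, hV, conjTranspose_one, Matrix.mul_one,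
      one_kronecker_one]
  refine EReal.ge_of_forall_gt_iff_ge.1 fun β hβ => ?_
  obtain ⟨τ, ⟨hτ0, hτ1, ω, hω, htr, hle⟩, hfid⟩ :=
    exists_mem_highEntropySet_of_lt_smoothMinEntropy hε hβ
  have hconj : ((1 : Matrix a a ℂ) ⊗ₖ V)ᴴ * ((1 : Matrix a a ℂ) ⊗ₖ ω) * ((1 : Matrix a a ℂ) ⊗ₖ V)
      = (1 : Matrix a a ℂ) ⊗ₖ (Vᴴ * ω * V) := by
    rw [conjTranspose_kronecker, ← mul_kronecker_mul, ← mul_kronecker_mul, conjTranspose_one,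
      Matrix.one_mul, Matrix.one_mul]
  refine le_smoothMinEntropy hε ⟨hτ0.conjTranspose_mul_mul_same _, (trace_conj hW τ).symm ▸ hτ1, _,
    hω.conjTranspose_mul_mul_same V, (trace_conj hV ω).symm ▸ htr, ?_⟩
    ((fidelity_conj hW hρ hτ0).symm ▸ hfid)
  rw [le_iff, ← hconj, ← Matrix.sub_mul, ← Matrix.mul_sub]
  exact (le_iff.1 hle).conjTranspose_mul_mul_same _

end Isometry

section Embedding

variable {n n' : Type*} [Fintype n] [DecidableEq n'] {ι : n → n'}

/-- The operator `V M V†`, where `V` is the linear map that sends the basis vector `|p⟩` to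
`|ι p⟩`; an isometry if `ι` is injective. -/
def embed (ι : n → n') (M : Matrix n n ℂ) : Matrix n' n' ℂ :=
  ((1 : Matrix n' n' ℂ).submatrix ι id)ᴴ * M * (1 : Matrix n' n' ℂ).submatrix ι id

theorem embed_apply_eq_zero {M : Matrix n n ℂ} {p q : n'}
    (h : ∀ r s, ι r = p → ι s = q → M r s = 0) : embed ι M p q = 0 := by
  simp only [embed, mul_apply, Finset.sum_mul, conjTranspose_apply, submatrix_apply, one_apply]
  refine Finset.sum_eq_zero fun s _ => Finset.sum_eq_zero fun r _ => ?_
  split_ifs with hr hs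
  · rw [h r s hr hs, mul_zero, zero_mul]
  all_goals simp

theorem embed_prodMap_id {a : Type*} [Fintype a] [DecidableEq a] (M : Matrix (a × n) (a × n) ℂ) :
    embed (Prod.map id ι) M = ((1 : Matrix a a ℂ) ⊗ₖ (1 : Matrix n' n' ℂ).submatrix ι id)ᴴ * M *
      ((1 : Matrix a a ℂ) ⊗ₖ (1 : Matrix n' n' ℂ).submatrix ι id) := by
  have hV : (1 : Matrix (a × n') (a × n') ℂ).submatrix (Prod.map id ι) id
      = (1 : Matrix a a ℂ) ⊗ₖ (1 : Matrix n' n' ℂ).submatrix ι id := by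
    rw [← one_kronecker_one]
    rfl
  rw [embed, hV]

variable [Fintype n']

theorem trace_embed_mul (M : Matrix n n ℂ) (N : Matrix n' n' ℂ) :
    (embed ι M * N).trace = (M * N.submatrix ι ι).trace := by
  have hcompress : (1 : Matrix n' n' ℂ).submatrix ι id * N * ((1 : Matrix n' n' ℂ).submatrix ι id)ᴴ
      = N.submatrix ι ι := by
    ext r s
    simp [mul_apply, one_apply]
  rw [embed, Matrix.mul_assoc, Matrix.mul_assoc, trace_mul_comm, Matrix.mul_assoc, hcompress]

theorem partialTrace_embed {a b : Type*} [Finite a] [DecidableEq a] [DecidableEq b]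
    (keep : n' → a) (discard : n' → b) (M : Matrix n n ℂ) :
    partialTrace keep discard (embed ι M) = partialTrace (keep ∘ ι) (discard ∘ ι) M := by
  have := Fintype.ofFinite a
  refine Matrix.ext_iff_trace_mul_right.2 fun N => ?_
  rw [trace_partialTrace_mul, trace_embed_mul, trace_partialTrace_mul]
  rfl

theorem partialTrace_comp [DecidableEq n] {n' k b : Type*} [Finite n'] [DecidableEq n']
    [Fintype k] [DecidableEq b] (ι : n → n') (keep : k → n) (discard : k → b)
    (M : Matrix k k ℂ) :
    partialTrace (ι ∘ keep) discard M = embed ι (partialTrace keep discard M) := by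
  have := Fintype.ofFinite n'
  refine Matrix.ext_iff_trace_mul_right.2 fun N => ?_
  rw [trace_partialTrace_mul, trace_embed_mul, trace_partialTrace_mul]
  rfl

end Embedding

section IsometricEmbedding

variable {n n' : Type*} [Fintype n'] [DecidableEq n'] {ι : n → n'}

theorem submatrix_one_mul_conjTranspose [DecidableEq n] (hι : Function.Injective ι) :
    (1 : Matrix n' n' ℂ).submatrix ι id * ((1 : Matrix n' n' ℂ).submatrix ι id)ᴴ = 1 := by
  rw [conjTranspose_submatrix, conjTranspose_one, ← submatrix_mul _ _ _ _ _ Function.bijective_id,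
    Matrix.one_mul, submatrix_one _ hι]

variable [Fintype n]

theorem isState_embed (hι : Function.Injective ι) {ρ : Matrix n n ℂ} (hρ : IsState ρ) :
    IsState (embed ι ρ) := by
  classical
  exact ⟨hρ.1.conjTranspose_mul_mul_same _,
    (trace_conj (submatrix_one_mul_conjTranspose hι) ρ).trans hρ.2⟩

theorem smoothMinEntropy_le_embed [DecidableEq n] {a : Type*} [Fintype a] [DecidableEq a]
    (hι : Function.Injective ι) {ε : ℝ} (hε : 0 ≤ ε) {ρ : Matrix (a × n) (a × n) ℂ}
    (hρ : ρ.PosSemidef) :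
    smoothMinEntropy ε ρ ≤ smoothMinEntropy ε (embed (Prod.map id ι) ρ) := by
  rw [embed_prodMap_id]
  exact smoothMinEntropy_le_conj (submatrix_one_mul_conjTranspose hι) hε hρ

end IsometricEmbedding

section ClassicalQuantum

theorem isState_single {n : Type*} [Fintype n] [DecidableEq n] (i : n) :
    IsState (single i i (1 : ℂ)) := by
  refine ⟨?_, trace_single_eq_same i 1⟩
  simpa using posSemidef_conjTranspose_mul_self (single i i (1 : ℂ))

theorem exists_isState_smul_eq {n : Type*} [Fintype n] [Nonempty n] {A : Matrix n n ℂ}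
    (hA : A.PosSemidef) : ∃ ρ, IsState ρ ∧ A = (A.trace.re : ℂ) • ρ := by
  classical
  have htr : (A.trace.re : ℂ) = A.trace :=
    Complex.ext rfl (Complex.nonneg_iff.1 hA.trace_nonneg).2
  rw [htr]
  by_cases h0 : A.trace = 0
  · refine ⟨_, isState_single (Classical.arbitrary n), ?_⟩
    rw [hA.trace_eq_zero_iff.1 h0, trace_zero, zero_smul]
  · refine ⟨A.trace⁻¹ • A, ⟨hA.smul (inv_nonneg.2 hA.trace_nonneg), ?_⟩,
      (smul_inv_smul₀ h0 A).symm⟩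
    rw [trace_smul, smul_eq_mul, inv_mul_cancel₀ h0]

variable {X E : Type*} [Fintype X] [DecidableEq X]

theorem sum_smul_single_kronecker_apply (P : X → ℂ) (ρE : X → Matrix E E ℂ) (p q : X × E) :
    (∑ x, P x • (single x x (1 : ℂ) ⊗ₖ ρE x)) p q
      = if p.1 = q.1 then P p.1 * ρE p.1 p.2 q.2 else 0 := by
  rw [Matrix.sum_apply]
  simp only [Matrix.smul_apply, kroneckerMap_apply, single_apply, smul_eq_mul, ite_mul, one_mul,
    zero_mul, mul_ite, mul_zero, ite_and, Finset.sum_ite_eq', Finset.mem_univ, if_true]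

theorem isCQState_iff [Fintype E] {ρ : Matrix (X × E) (X × E) ℂ} :
    IsCQState ρ ↔ IsState ρ ∧ ∀ p q : X × E, p.1 ≠ q.1 → ρ p q = 0 := by
  refine ⟨fun ⟨P, ρE, hP, hP1, hρE, h⟩ => ⟨⟨?_, ?_⟩, ?_⟩, fun ⟨⟨hρ, htr⟩, hoff⟩ => ?_⟩
  · rw [h]
    exact posSemidef_sum _ fun x _ =>
      ((isState_single x).1.kronecker (hρE x).1).smul (Complex.zero_le_real.2 (hP x))
  · rw [h, trace_sum]
    simp only [trace_smul, trace_kronecker, trace_single_eq_same, (hρE _).2, smul_eq_mul, mul_one]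
    exact_mod_cast hP1
  · intro p q hpq
    rw [h, sum_smul_single_kronecker_apply, if_neg hpq]
  · have hE : Nonempty E := by
      by_contra hE
      simp [trace, not_nonempty_iff.1 hE] at htr
    have hblock (x : X) : (ρ.submatrix (Prod.mk x) (Prod.mk x)).PosSemidef := hρ.submatrix _
    choose ρE hρE hsplit using fun x => exists_isState_smul_eq (hblock x)
    refine ⟨_, ρE, fun x => re_trace_nonneg (hblock x), ?_, hρE, ?_⟩
    · rw [← Complex.re_sum, ← Complex.one_re, ← htr, trace, Fintype.sum_prod_type]
      rfl
    · ext ⟨x, e⟩ ⟨x', e'⟩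
      rw [sum_smul_single_kronecker_apply]
      split_ifs with hxx'
      · obtain rfl : x = x' := hxx'
        exact congrFun₂ (hsplit x) e e'
      · exact hoff _ _ hxx'

end ClassicalQuantum

section ConstantIndex

variable {m : ℕ} {X E : Fin m → Type*}

/-- The inclusion of the basis of `X E` into that of `X V E` with constant value `V = v₀`, which
makes `embed (withIndex v₀) ρ` the state `ρ` with a deterministic register `V = v₀` added. -/
def withIndex (v₀ : Fin m) (p : (∀ k, X k) × (∀ k, E k)) :
    ((∀ k, X k) × Fin m) × (∀ k, E k) :=
  ((p.1, v₀), p.2)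

theorem withIndex_injective (v₀ : Fin m) :
    Function.Injective (withIndex v₀ : _ → ((∀ k, X k) × Fin m) × (∀ k, E k)) := by
  rintro ⟨x, e⟩ ⟨x', e'⟩ h
  simp only [withIndex, Prod.mk.injEq] at h
  exact Prod.ext h.1.1 h.2

variable [∀ i, Fintype (X i)] [∀ i, Fintype (E i)]

theorem condNe_eq_self {τ : Matrix (((∀ k, X k) × Fin m) × (∀ k, E k))
      (((∀ k, X k) × Fin m) × (∀ k, E k)) ℂ} {v : Fin m} (htr : τ.trace = 1)
    (hτ : ∀ p q, p.1.2 = v ∨ q.1.2 = v → τ p q = 0) : condNe τ v = τ := by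
  have hprob : probNe τ v = 1 := by
    rw [probNe, ← Complex.one_re, ← htr, trace, Complex.re_sum]
    refine Finset.sum_congr rfl fun p _ => ?_
    split_ifs with hp
    · rfl
    · rw [diag_apply, hτ p p (.inl (not_not.1 hp)), Complex.zero_re]
  ext p q
  rw [condNe, of_apply, hprob, Complex.ofReal_one, inv_one, one_mul]
  split_ifs with hpq
  · rfl
  · exact (hτ p q (by tauto)).symm

variable [∀ i, DecidableEq (X i)] [∀ i, DecidableEq (E i)]

theorem isCQState_embed_productState (v₀ : Fin m) {ρ : ∀ i, Matrix (X i × E i) (X i × E i) ℂ}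
    (hρ : ∀ i, IsCQState (ρ i)) : IsCQState (embed (withIndex v₀) (productState ρ)) := by
  refine isCQState_iff.2 ⟨isState_embed (withIndex_injective v₀)
    (isState_productState fun i => (isCQState_iff.1 (hρ i)).1), fun p q hpq =>
    embed_apply_eq_zero ?_⟩
  rintro ⟨x, e⟩ ⟨x', e'⟩ rfl rfl
  obtain ⟨k, hk⟩ : ∃ k, x k ≠ x' k := by
    by_contra! h
    exact hpq (congrArg (·, v₀) (funext h))
  exact Finset.prod_eq_zero (Finset.mem_univ k) ((isCQState_iff.1 (hρ k)).2 _ _ hk)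

theorem forgetV_embed (v₀ : Fin m)
    (M : Matrix ((∀ k, X k) × (∀ k, E k)) ((∀ k, X k) × (∀ k, E k)) ℂ) :
    forgetV (embed (withIndex v₀) M) = M := by
  rw [forgetV, partialTrace_embed]
  ext p q
  simp [partialTrace, withIndex, ite_and]

theorem embed_withIndex_apply_eq_zero {v₀ : Fin m}
    (M : Matrix ((∀ k, X k) × (∀ k, E k)) ((∀ k, X k) × (∀ k, E k)) ℂ)
    {p q : ((∀ k, X k) × Fin m) × (∀ k, E k)} (h : p.1.2 ≠ v₀ ∨ q.1.2 ≠ v₀) :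
    embed (withIndex v₀) M p q = 0 := by
  refine embed_apply_eq_zero ?_
  rintro r s rfl rfl
  exact absurd h (by simp [withIndex])

theorem probNe_embed_self (v₀ : Fin m)
    (M : Matrix ((∀ k, X k) × (∀ k, E k)) ((∀ k, X k) × (∀ k, E k)) ℂ) :
    probNe (embed (withIndex v₀) M) v₀ = 0 := by
  refine Finset.sum_eq_zero fun p _ => ?_
  split_ifs with hp
  · rw [embed_withIndex_apply_eq_zero M (.inl hp), Complex.zero_re]
  · rfl

theorem localState_embed_productState (v v₀ : Fin m)
    {ρ : ∀ i, Matrix (X i × E i) (X i × E i) ℂ} (hρ : ∀ i, (ρ i).trace = 1) :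
    localState (embed (withIndex v₀) (productState ρ)) v
      = embed (Prod.map id (·, v₀)) (ρ v) := by
  rw [localState, partialTrace_embed, ← partialTrace_productState v hρ, ← partialTrace_comp]
  rfl

theorem exists_index_of_forall_ne_le (v₀ : Fin m) {ρ : ∀ i, Matrix (X i × E i) (X i × E i) ℂ}
    (hρ : ∀ i, IsCQState (ρ i)) {ε : ℝ} (hε : 0 ≤ ε) {β : EReal}
    (hβ : ∀ v, v ≠ v₀ → β ≤ smoothMinEntropy ε (ρ v)) :
    ∃ τ : Matrix (((∀ k, X k) × Fin m) × (∀ k, E k)) (((∀ k, X k) × Fin m) × (∀ k, E k)) ℂ,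
      IsCQState τ ∧ forgetV τ = productState ρ ∧
        ∀ v, 0 < probNe τ v → β ≤ smoothMinEntropy ε (localState (condNe τ v) v) := by
  have hstate i : IsState (ρ i) := (isCQState_iff.1 (hρ i)).1
  have hcq := isCQState_embed_productState v₀ hρ
  refine ⟨_, hcq, forgetV_embed v₀ _, fun v hv => ?_⟩
  have hne : v ≠ v₀ := by
    rintro rfl
    exact hv.ne' (probNe_embed_self v _)
  have hcond : condNe (embed (withIndex v₀) (productState ρ)) v
      = embed (withIndex v₀) (productState ρ) :=
    condNe_eq_self (isCQState_iff.1 hcq).1.2 fun p q hpq => embed_withIndex_apply_eq_zero _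
      (hpq.imp (·.trans_ne hne) (·.trans_ne hne))
  rw [hcond, localState_embed_productState v v₀ fun i => (hstate i).2]
  exact (hβ v hne).trans
    (smoothMinEntropy_le_embed (Prod.mk_left_injective v₀) hε (hstate v).1)

end ConstantIndex

theorem logb_two_three_div_two_le_logb {m : ℕ} (hm : 2 ≤ m) :
    Real.logb 2 3 / 2 ≤ Real.logb 2 m := by
  have hm' : (2 : ℝ) ≤ m := mod_cast hm
  rw [div_le_iff₀ two_pos, mul_comm, ← Nat.cast_two, ← Real.logb_pow, Nat.cast_two]
  exact Real.logb_le_logb_of_le one_lt_two three_pos (by nlinarith)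

end QInfo

theorem mainTheorem11_general {m : ℕ} (hm : 0 < m) {X E : Fin m → Type*}
    [∀ i, Fintype (X i)] [∀ i, DecidableEq (X i)] [∀ i, Fintype (E i)] [∀ i, DecidableEq (E i)]
    {ε : ℝ} (hε : 0 ≤ ε) {α : ℝ} {ρ : ∀ i, Matrix (X i × E i) (X i × E i) ℂ}
    (hρ : ∀ i, QInfo.IsState (ρ i))
    (hα : ∀ i j : Fin m, i ≠ j →
      (α : EReal) ≤ QInfo.smoothMinEntropy (ε ^ 2)
        (QInfo.pairState (QInfo.productState ρ) i j)) :
    ∃ v₀ : Fin m, ∀ v, v ≠ v₀ →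
      ((α / 2 - Real.logb 2 3 / 2 : ℝ) : EReal) ≤ QInfo.smoothMinEntropy ε (ρ v) := by
  by_contra! hlow
  obtain ⟨i, -, hi⟩ := hlow ⟨0, hm⟩
  obtain ⟨j, hji, hj⟩ := hlow i
  obtain ⟨β, hβi, hβ⟩ := EReal.lt_iff_exists_real_btwn.1 hi
  obtain ⟨β', hβ'j, hβ'⟩ := EReal.lt_iff_exists_real_btwn.1 hj
  have hle := (hα i j hji.symm).trans
    (QInfo.smoothMinEntropy_pairState_le hρ hε hji.symm hβi hβ'j)
  rw [EReal.coe_le_coe_iff] at hle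
  rw [EReal.coe_lt_coe_iff] at hβ hβ'
  linarith

theorem mainTheorem11 {m : ℕ} (hm : 0 < m) {X E : Fin m → Type*}
    [∀ i, Fintype (X i)] [∀ i, DecidableEq (X i)]
    [∀ i, Fintype (E i)] [∀ i, DecidableEq (E i)]
    (ε : ℝ) (hε : 0 ≤ ε) (α : ℝ)
    (ρ : ∀ i, Matrix (X i × E i) (X i × E i) ℂ)
    (hρ : ∀ i, QInfo.IsCQState (ρ i))
    (hα : ∀ i j : Fin m, i ≠ j →
      (α : EReal) ≤ QInfo.smoothMinEntropy (ε ^ 2)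
        (QInfo.pairState (QInfo.productState ρ) i j)) :
    ∃ τ : Matrix (((∀ k, X k) × Fin m) × (∀ k, E k))
        (((∀ k, X k) × Fin m) × (∀ k, E k)) ℂ,
      QInfo.IsCQState τ ∧ QInfo.forgetV τ = QInfo.productState ρ ∧
      ∀ v : Fin m, 0 < QInfo.probNe τ v →
        ((α / 2 - Real.logb 2 m : ℝ) : EReal) ≤
          QInfo.smoothMinEntropy ε (QInfo.localState (QInfo.condNe τ v) v) := by
  obtain ⟨v₀, hv₀⟩ :=
    mainTheorem11_general hm hε (fun i => (QInfo.isCQState_iff.1 (hρ i)).1) hα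
  refine QInfo.exists_index_of_forall_ne_le v₀ hρ hε fun v hv => le_trans ?_ (hv₀ v hv)
  have hm2 : 2 ≤ m := Fin.nontrivial_iff_two_le.1 ⟨v, v₀, hv⟩
  exact EReal.coe_le_coe (sub_le_sub_left (QInfo.logb_two_three_div_two_le_logb hm2) _)
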